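/- Let $D\ge 1$, $R\ge 1$ be integers and $h$ a real number. There are constants $a_0,b_0>0$, depending only on $R$, $h$ and $D$, such that the following holds. Let $M\in\mathbb N$ satisfy $4^{3/2}R\le M^{3/5}$, let $\mathcal L=\{1,\dots,M\}^{D}$, $N=M^D$, with $\mathrm{dist}(i,j)$ the length of a shortest lattice path from $i$ to $j$ (with open or periodic boundary conditions in each direction; for open boundary conditions $\mathrm{dist}(i,j)=\sum_{\delta}|i_\delta-j_\delta|$). To each site $i$ attach a space $\mathbb C^{d_i}$ with $1\le d_i<\infty$, put $d=\prod_i d_i$, and let $H=\sum_{i\in\mathcal L}h_i$ be a self-adjoint operator on $\bigotimes_{i\in\mathcal L}\mathbb C^{d_i}$ such that each $h_i$ acts non-trivially only on $\{j\in\mathcal L:\mathrm{dist}(i,j)\le R\}$ and has operator norm $\|h_i\|\le h$. Write $\langle A\rangle=\mathrm{tr}[A]/d$, $\sigma^2=\langle(H-\langle H\rangle)^2\rangle$, $\bar\sigma=\sqrt{\sigma^2/N}$ and $\phi(t)=\mathrm{tr}[\mathrm e^{\mathrm i tH}]/d$, and assume $\bar\sigma>0$. Then, for $$T=a_0\,\bar\sigma^2\,N^{\frac1{5D}-\frac12},$$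 one has $$\frac1T\int_0^T|\phi(t)|\,\mathrm dt\;\le\;\frac{b_0\,(1+\bar\sigma^{-3})}{N^{1/(5D)}}.$$ -/

import Mathlib

open scoped Matrix.Norms.L2Operator

noncomputable section

namespace LocalHam

/-- The sites of the cubic lattice `{1, …, M}^D`, with coordinates labelled by `Fin M`. -/
abbrev Site (D M : ℕ) : Type := Fin D → Fin M

/-- Distance of two coordinates on the path (`periodic = false`) or on the cycle
(`periodic = true`) with `M` vertices. -/
def coordDist {M : ℕ} (periodic : Bool) (a b : Fin M) : ℕ :=
  let e := ((a : ℤ) - (b : ℤ)).natAbs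
  if periodic then min e (M - e) else e

/-- Length of a shortest lattice path between two sites. The boundary condition in direction `δ`
is periodic if `bc δ = true` and open if `bc δ = false`; with open boundary conditions in all
directions this is `∑ δ, |i δ - j δ|`. -/
def siteDist {D M : ℕ} (bc : Fin D → Bool) (i j : Site D M) : ℕ :=
  ∑ δ, coordDist (bc δ) (i δ) (j δ)

/-- Labels `n = (n_i)` of the product basis `|n⟩` of the Hilbert space `⨂ i, ℂ^(d i)`. -/
abbrev Config {D M : ℕ} (d : Site D M → ℕ) : Type := ∀ i, Fin (d i)

/-- Operators on `⨂ i, ℂ^(d i)`, as matrices in the product basis. The norm `‖·‖` on them is the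
operator norm induced by the Euclidean norm. -/
abbrev Operator {D M : ℕ} (d : Site D M → ℕ) : Type := Matrix (Config d) (Config d) ℂ

/-- `A` acts non-trivially only on the sites in `S`: it is `B ⊗ 1` for an operator `B` on
`⨂ i ∈ S, ℂ^(d i)` and the identity on the remaining sites. -/
def ActsOn {D M : ℕ} {d : Site D M → ℕ} (S : Set (Site D M)) (A : Operator d) : Prop :=
  ∃ B : Matrix (∀ j : S, Fin (d j)) (∀ j : S, Fin (d j)) ℂ, ∀ x y : Config d,
    ((∀ j, j ∉ S → x j = y j) → A x y = B (fun j => x j) (fun j => y j)) ∧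
    ((∃ j, j ∉ S ∧ x j ≠ y j) → A x y = 0)

/-- `H` is a local Hamiltonian with interaction radius `R` and interaction strength `h`: it is
self-adjoint and a sum of terms, one for each site `i`, of operator norm at most `h` and acting
non-trivially only on the ball of radius `R` around `i`. -/
structure IsLocalHamiltonian {D M : ℕ} (bc : Fin D → Bool) (R : ℕ) (h : ℝ)
    (d : Site D M → ℕ) (H : Operator d) : Prop where
  isHermitian : H.IsHermitian
  exists_terms : ∃ term : Site D M → Operator d, H = ∑ i, term i ∧
    ∀ i, ActsOn {j | siteDist bc i j ≤ R} (term i) ∧ ‖term i‖ ≤ h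

/-- The expectation value `⟨A⟩ = tr A / dim` in the maximally mixed state. -/
def expect {D M : ℕ} {d : Site D M → ℕ} (A : Operator d) : ℂ :=
  A.trace / (Fintype.card (Config d) : ℂ)

/-- The energy variance `σ² = ⟨(H - ⟨H⟩)²⟩` (a real number for self-adjoint `H`). -/
def energyVar {D M : ℕ} {d : Site D M → ℕ} (H : Operator d) : ℝ :=
  (expect ((H - expect H • (1 : Operator d)) ^ 2)).re

/-- `σ̄ = √(σ² / N)`, where `N = M ^ D` is the number of sites. -/
def sigmaBar {D M : ℕ} {d : Site D M → ℕ} (H : Operator d) : ℝ :=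
  √(energyVar H / ((M ^ D : ℕ) : ℝ))

/-- The Fourier transform of the spectral density, `φ(t) = tr[exp(i t H)] / dim`. -/
def phi {D M : ℕ} {d : Site D M → ℕ} (H : Operator d) (t : ℝ) : ℂ :=
  expect (NormedSpace.exp ((Complex.I * (t : ℂ)) • H))

end LocalHam

end

/-! After subtracting its mean, `H` is a sum of centered self-adjoint local terms, and `φ` changes
only by a phase. In the maximally mixed state, operators on disjoint regions are independent, so the
spectral distribution behaves like that of a sum of weakly dependent variables, and a central-limit
argument in Fourier space applies.

Put `m = M^(1/5) = N^(1/(5D))` and cut the lattice along one direction into about `m²` slabs of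
width about `m³`. Choose `k` of them and delete the terms near their faces. Duhamel's formula and
Cauchy–Schwarz bound the change of `φ(t)` by `t` times the root mean square of the deleted terms,
hence by a multiple of `t √(k M^(D-1))` (`norm_ntr_evol_sub_le`). What is left factorizes into `k`
block characteristic functions and a factor of modulus at most one (`norm_ntr_evol_sum_add_le`).

Each block obeys a Gaussian bound, by Taylor expansion with the fourth moment as error
(`norm_ntr_evol_le_exp`). The fourth moment is of the order of the squared block size, since a
product of four terms has zero trace if one of them is isolated (`mom4_sum_le`). The time `T` is so
short that this error stays below the variance term.

The number `k` depends on `t`: small times allow many blocks, later times need few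
(`le_gaussian_add_of_forall_le`). Averaging over `[0, T]` then gives order `1/m`. The argument needs
the slab interiors to carry a fixed share of the variance. If that can fail, `σ̄ m` is bounded and
the trivial bound `|φ| ≤ 1` suffices. -/

namespace LocalHam

/-! ### Taylor bounds for the exponential on the imaginary axis. -/

section ScalarTaylor

theorem norm_cexp_taylor_two_le_of_nonneg {x : ℝ} (hx : 0 ≤ x) :
    ‖Complex.exp (Complex.I * x) - 1 - Complex.I * x‖ ≤ x ^ 2 / 2 := by
  have h := image_norm_le_of_norm_deriv_right_le_deriv_boundary
    (f := fun y : ℝ => Complex.exp (Complex.I * y) - 1 - Complex.I * y)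
    (f' := fun y : ℝ => Complex.exp (Complex.I * y) * (Complex.I * 1) - Complex.I * 1)
    (a := 0) (b := x) (B := fun y => y ^ 2 / 2) (B' := fun y => y)
    (by fun_prop) ?_ (by simp) ?_ ?_ (x := x) ⟨hx, le_rfl⟩
  · simpa using h
  · intro y _
    have h1 : HasDerivAt (fun y : ℝ => Complex.I * (y : ℂ)) (Complex.I * 1) y :=
      (Complex.ofRealCLM.hasDerivAt.const_mul Complex.I)
    exact ((h1.cexp.sub_const 1).sub h1).hasDerivWithinAt
  · intro y
    have := (hasDerivAt_pow 2 y).div_const 2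
    convert! this using 1
    simp
  · intro y hy
    have := Real.norm_exp_I_mul_ofReal_sub_one_le (x := y)
    rw [Real.norm_of_nonneg hy.1] at this
    calc _ = ‖Complex.I * (Complex.exp (Complex.I * y) - 1)‖ := by congr 1; ring
      _ ≤ y := by simpa using this

theorem norm_cexp_taylor_three_le_of_nonneg {x : ℝ} (hx : 0 ≤ x) :
    ‖Complex.exp (Complex.I * x) - 1 - Complex.I * x + x ^ 2 / 2‖ ≤ x ^ 3 / 6 := by
  have h := image_norm_le_of_norm_deriv_right_le_deriv_boundary
    (f := fun y : ℝ => Complex.exp (Complex.I * y) - 1 - Complex.I * y + y ^ 2 / 2)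
    (f' := fun y : ℝ => Complex.exp (Complex.I * y) * (Complex.I * 1) - Complex.I * 1 + y)
    (a := 0) (b := x) (B := fun y => y ^ 3 / 6) (B' := fun y => y ^ 2 / 2)
    (by fun_prop) ?_ (by simp) ?_ ?_ (x := x) ⟨hx, le_rfl⟩
  · simpa using h
  · intro y _
    have h0 : HasDerivAt (fun y : ℝ => (y : ℂ)) 1 y := Complex.ofRealCLM.hasDerivAt
    have h1 : HasDerivAt (fun y : ℝ => Complex.I * (y : ℂ)) (Complex.I * 1) y := h0.const_mul _
    have h2 : HasDerivAt (fun y : ℝ => (y : ℂ) ^ 2 / 2) (y : ℂ) y := by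
      convert! (h0.pow 2).div_const 2 using 1
      simp
    exact (((h1.cexp.sub_const 1).sub h1).add h2).hasDerivWithinAt
  · intro y
    have := (hasDerivAt_pow 3 y).div_const 6
    convert! this using 1
    simp; ring
  · intro y hy
    calc _ = ‖Complex.I * (Complex.exp (Complex.I * y) - 1 - Complex.I * y)‖ := by
          congr 1; linear_combination (y : ℂ) * Complex.I_sq
      _ ≤ y ^ 2 / 2 := by simpa using norm_cexp_taylor_two_le_of_nonneg hy.1

/-- The cubic remainder is traded for even powers through `2|x|³ ≤ x² + x⁴`, so that only moments
expressible as traces of powers occur. -/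
theorem norm_cexp_taylor_three_le (x : ℝ) :
    ‖Complex.exp (Complex.I * x) - 1 - Complex.I * x + x ^ 2 / 2‖ ≤ (x ^ 2 + x ^ 4) / 12 := by
  have key : ‖Complex.exp (Complex.I * x) - 1 - Complex.I * x + x ^ 2 / 2‖ ≤ |x| ^ 3 / 6 := by
    rcases le_total 0 x with hx | hx
    · rw [abs_of_nonneg hx]; exact norm_cexp_taylor_three_le_of_nonneg hx
    · rw [abs_of_nonpos hx]
      have := norm_cexp_taylor_three_le_of_nonneg (x := -x) (by linarith)
      rw [← Complex.norm_conj] at this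
      refine le_trans (le_of_eq ?_) this
      congr 1
      have h2 : (starRingEnd ℂ) 2 = 2 := Complex.conj_ofNat 2
      simp [← Complex.exp_conj, h2, sub_eq_add_neg]
  have h2 : |x| ^ 2 = x ^ 2 := sq_abs x
  have h4 : |x| ^ 4 = x ^ 4 := by
    rw [show |x| ^ 4 = (|x| ^ 2) ^ 2 by ring, h2]; ring
  nlinarith [sq_nonneg (|x| * (|x| - 1))]

end ScalarTaylor

/-! ### Normalized trace, moments and characteristic functions of matrices. -/

section NormalizedTrace

variable {n : Type*} [Fintype n]

/-- The trace normalized to be one at the identity. -/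
noncomputable def ntr (A : Matrix n n ℂ) : ℂ := A.trace / (Fintype.card n : ℂ)

theorem ntr_add (A B : Matrix n n ℂ) : ntr (A + B) = ntr A + ntr B := by
  simp [ntr, add_div]

theorem ntr_sub (A B : Matrix n n ℂ) : ntr (A - B) = ntr A - ntr B := by
  simp [ntr, sub_div]

theorem ntr_smul (c : ℂ) (A : Matrix n n ℂ) : ntr (c • A) = c * ntr A := by
  simp [ntr, mul_div_assoc]

theorem ntr_sum {ι : Type*} (s : Finset ι) (A : ι → Matrix n n ℂ) :
    ntr (∑ i ∈ s, A i) = ∑ i ∈ s, ntr (A i) := by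
  simp [ntr, Matrix.trace_sum, Finset.sum_div]

theorem ntr_mul_comm (A B : Matrix n n ℂ) : ntr (A * B) = ntr (B * A) := by
  rw [ntr, Matrix.trace_mul_comm, ntr]

theorem continuous_ntr : Continuous (ntr : Matrix n n ℂ → ℂ) := by
  have : Continuous (fun A : Matrix n n ℂ => A.trace) :=
    (Matrix.traceLinearMap n ℂ ℂ).continuous_of_finiteDimensional
  exact this.div_const _

variable [DecidableEq n]

/-- The second moment `⟨A²⟩` of a self-adjoint matrix. -/
noncomputable def mom2 (A : Matrix n n ℂ) : ℝ := (ntr (A ^ 2)).re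

/-- The fourth moment `⟨A⁴⟩` of a self-adjoint matrix. -/
noncomputable def mom4 (A : Matrix n n ℂ) : ℝ := (ntr (A ^ 4)).re

/-- The unitary `exp (i t A)`. -/
noncomputable def evol (A : Matrix n n ℂ) (t : ℝ) : Matrix n n ℂ :=
  NormedSpace.exp ((Complex.I * (t : ℂ)) • A)

theorem ntr_one [Nonempty n] : ntr (1 : Matrix n n ℂ) = 1 := by
  simp [ntr, Matrix.trace_one]

theorem norm_ntr_le [Nonempty n] (A : Matrix n n ℂ) : ‖ntr A‖ ≤ ‖A‖ := by
  have hent : ∀ i, ‖A i i‖ ≤ ‖A‖ := by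
    intro i
    have h1 := Matrix.l2_opNorm_mulVec A (EuclideanSpace.single i (1 : ℂ))
    have h2 := PiLp.norm_apply_le
      ((EuclideanSpace.equiv n ℂ).symm (A.mulVec (EuclideanSpace.single i (1 : ℂ)).ofLp)) i
    have h3 : (A.mulVec (EuclideanSpace.single i (1 : ℂ)).ofLp) i = A i i := by simp
    simp only [PiLp.norm_single, norm_one, mul_one] at h1
    refine le_trans (le_of_eq ?_) (h2.trans h1)
    rw [← h3]; rfl
  have hc : (0 : ℝ) < Fintype.card n := by exact_mod_cast Fintype.card_pos
  rw [ntr, norm_div, Complex.norm_natCast, div_le_iff₀ hc, Matrix.trace]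
  calc ‖∑ i, A.diag i‖ ≤ ∑ _i : n, ‖A‖ := norm_sum_le_of_le _ fun i _ => hent i
    _ = ‖A‖ * Fintype.card n := by simp [mul_comm]

theorem evol_hermitian_unitary {A : Matrix n n ℂ} (hA : A.IsHermitian) (t : ℝ) :
    evol A t ∈ Matrix.unitaryGroup n ℂ := by
  have hs : star (evol A t) = evol A (-t) := by
    rw [evol, Matrix.star_eq_conjTranspose, ← Matrix.exp_conjTranspose, evol,
      Matrix.conjTranspose_smul, hA.eq]
    simp
  rw [Matrix.mem_unitaryGroup_iff, hs, evol, evol, ← Matrix.exp_add_of_commute]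
  · rw [← add_smul]; simp
  · exact (Commute.refl A).smul_left _ |>.smul_right _

theorem norm_evol_le {A : Matrix n n ℂ} (hA : A.IsHermitian) (t : ℝ) : ‖evol A t‖ ≤ 1 := by
  have h := Matrix.l2_opNorm_conjTranspose_mul_self (evol A t)
  rw [← Matrix.star_eq_conjTranspose,
    Matrix.mem_unitaryGroup_iff'.mp (evol_hermitian_unitary hA t)] at h
  have h1 : ‖(1 : Matrix n n ℂ)‖ ≤ 1 := by
    rw [← Matrix.diagonal_one, Matrix.l2_opNorm_diagonal]
    exact (pi_norm_le_iff_of_nonneg zero_le_one).2 fun i => by simp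
  nlinarith [norm_nonneg (evol A t)]

theorem norm_ntr_evol_le_one [Nonempty n] {A : Matrix n n ℂ} (hA : A.IsHermitian) (t : ℝ) :
    ‖ntr (evol A t)‖ ≤ 1 :=
  (norm_ntr_le _).trans (norm_evol_le hA t)

theorem continuous_evol (A : Matrix n n ℂ) : Continuous (evol A) := by
  let _ : NormedAlgebra ℚ (Matrix n n ℂ) := NormedAlgebra.restrictScalars ℚ ℂ _
  unfold evol
  exact NormedSpace.exp_continuous.comp (by fun_prop)

section Spectral

theorem ntr_conj_unitary (U : Matrix.unitaryGroup n ℂ) (A : Matrix n n ℂ) :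
    ntr ((U : Matrix n n ℂ) * A * star (U : Matrix n n ℂ)) = ntr A := by
  rw [ntr_mul_comm, ← mul_assoc, Matrix.mem_unitaryGroup_iff'.mp U.2, one_mul]

variable {A : Matrix n n ℂ} (hA : A.IsHermitian)
include hA

theorem hermitian_eq_conj : A = (hA.eigenvectorUnitary : Matrix n n ℂ) *
    Matrix.diagonal (fun i => (hA.eigenvalues i : ℂ)) *
      star (hA.eigenvectorUnitary : Matrix n n ℂ) := by
  conv_lhs => rw [hA.spectral_theorem, Unitary.conjStarAlgAut_apply]
  rfl

theorem ntr_pow_eq_sum (k : ℕ) :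
    ntr (A ^ k) = (((∑ i, hA.eigenvalues i ^ k) / Fintype.card n : ℝ) : ℂ) := by
  have hU := Matrix.mem_unitaryGroup_iff'.mp hA.eigenvectorUnitary.2
  have hU' := Matrix.mem_unitaryGroup_iff.mp hA.eigenvectorUnitary.2
  set U := (hA.eigenvectorUnitary : Matrix n n ℂ)
  set Λ := Matrix.diagonal (fun i => (hA.eigenvalues i : ℂ))
  have hpow : A ^ k = U * Λ ^ k * star U := by
    conv_lhs => rw [hermitian_eq_conj hA]
    induction k with
    | zero => simp [U, hU']
    | succ k ih =>
      rw [pow_succ, ih, pow_succ]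
      calc U * Λ ^ k * star U * (U * Λ * star U) = U * Λ ^ k * (star U * U) * Λ * star U := by
            simp only [mul_assoc]
        _ = _ := by rw [hU, mul_one]; simp only [mul_assoc]
  rw [hpow, ntr_conj_unitary, Matrix.diagonal_pow, ntr, Matrix.trace_diagonal]
  simp

theorem ntr_evol_eq_sum (t : ℝ) : ntr (evol A t) =
    (∑ i, Complex.exp (Complex.I * ((t * hA.eigenvalues i : ℝ) : ℂ))) / Fintype.card n := by
  have hexp : evol A t = (hA.eigenvectorUnitary : Matrix n n ℂ) *
      evol (Matrix.diagonal (fun i => (hA.eigenvalues i : ℂ))) t *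
        star (hA.eigenvectorUnitary : Matrix n n ℂ) := by
    have h := Matrix.exp_units_conj (Unitary.toUnits hA.eigenvectorUnitary)
      ((Complex.I * (t : ℂ)) • Matrix.diagonal (fun i => (hA.eigenvalues i : ℂ)))
    conv_lhs => rw [hermitian_eq_conj hA]
    rw [evol, evol, ← Unitary.val_toUnits_apply, ← smul_mul_assoc, ← mul_smul_comm]
    exact h
  rw [hexp, ntr_conj_unitary, evol, ← Matrix.diagonal_smul, Matrix.exp_diagonal, ntr,
    Matrix.trace_diagonal]
  congr 1
  refine Finset.sum_congr rfl fun i _ => ?_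
  rw [Pi.coe_exp, ← Complex.exp_eq_exp_ℂ]
  congr 1
  simp [mul_assoc]

theorem mom2_eq_sum : mom2 A = (∑ i, hA.eigenvalues i ^ 2) / Fintype.card n := by
  rw [mom2, ntr_pow_eq_sum hA, Complex.ofReal_re]

theorem mom4_eq_sum : mom4 A = (∑ i, hA.eigenvalues i ^ 4) / Fintype.card n := by
  rw [mom4, ntr_pow_eq_sum hA, Complex.ofReal_re]

theorem mom2_nonneg : 0 ≤ mom2 A := by
  rw [mom2_eq_sum hA]; positivity

theorem mom2_sq_le_mom4 [Nonempty n] : mom2 A ^ 2 ≤ mom4 A := by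
  have hc : (0 : ℝ) < Fintype.card n := by exact_mod_cast Fintype.card_pos
  have h := sq_sum_le_card_mul_sum_sq (s := Finset.univ) (f := fun i => hA.eigenvalues i ^ 2)
  simp only [← pow_mul, Finset.card_univ] at h
  norm_num at h
  rw [mom2_eq_sum hA, mom4_eq_sum hA, div_pow, div_le_div_iff₀ (by positivity) hc]
  calc _ ≤ (Fintype.card n * ∑ i, hA.eigenvalues i ^ 4) * (Fintype.card n : ℝ) := by gcongr
    _ = _ := by ring

/-- The characteristic function of the spectral distribution of a centered self-adjoint matrix
decays like a Gaussian as long as the fourth moment is under control. -/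
theorem norm_ntr_evol_le_exp [Nonempty n] (h0 : ntr A = 0) (t : ℝ) :
    ‖ntr (evol A t)‖ ≤
      Real.exp (-(5 / 12) * (t ^ 2 * mom2 A) + 5 / 24 * (t ^ 4 * mom4 A)) := by
  have hc : (0 : ℝ) < Fintype.card n := by exact_mod_cast Fintype.card_pos
  have hc' : (Fintype.card n : ℂ) ≠ 0 := by exact_mod_cast hc.ne'
  set l := hA.eigenvalues with hl
  have hsum0 : ∑ i, l i = 0 := by
    have := ntr_pow_eq_sum hA 1
    rw [pow_one, h0] at this
    have h := Complex.ofReal_eq_zero.mp this.symm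
    simpa [hc.ne'] using h
  have hm2 := mom2_eq_sum hA
  have hm4 := mom4_eq_sum hA
  have hsq := mom2_sq_le_mom4 hA
  rw [← hl] at hm2 hm4
  -- The linear Taylor term drops out because the eigenvalues sum to zero.
  have hdec : ntr (evol A t) = ((1 - t ^ 2 * mom2 A / 2 : ℝ) : ℂ) +
      (∑ i, (Complex.exp (Complex.I * ((t * l i : ℝ) : ℂ)) - 1 - Complex.I * ((t * l i : ℝ) : ℂ)
        + ((t * l i : ℝ) : ℂ) ^ 2 / 2)) / Fintype.card n := by
    have h1 : ∑ i, (Complex.I * ((t * l i : ℝ) : ℂ)) = 0 := by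
      rw [← Finset.mul_sum, ← Complex.ofReal_sum, ← Finset.mul_sum, hsum0]; simp
    have h2 : ∑ i, (((t * l i : ℝ) : ℂ) ^ 2 / 2) =
        ((t ^ 2 * mom2 A / 2 * Fintype.card n : ℝ) : ℂ) := by
      rw [hm2, show t ^ 2 * ((∑ i, l i ^ 2) / Fintype.card n) / 2 * Fintype.card n =
        ∑ i, (t * l i) ^ 2 / 2 by
          simp only [mul_pow, ← Finset.sum_div, ← Finset.mul_sum]
          field_simp]
      push_cast; rfl
    rw [Finset.sum_add_distrib, Finset.sum_sub_distrib, Finset.sum_sub_distrib, h1, h2,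
      ntr_evol_eq_sum hA]
    simp only [Finset.sum_const, Finset.card_univ, nsmul_eq_mul, mul_one]
    push_cast
    field_simp
    ring
  have hrem : ‖(∑ i, (Complex.exp (Complex.I * ((t * l i : ℝ) : ℂ)) - 1
      - Complex.I * ((t * l i : ℝ) : ℂ) + ((t * l i : ℝ) : ℂ) ^ 2 / 2)) / (Fintype.card n : ℂ)‖
      ≤ (t ^ 2 * mom2 A + t ^ 4 * mom4 A) / 12 := by
    rw [norm_div, Complex.norm_natCast, div_le_iff₀ hc]
    calc _ ≤ ∑ i, ((t * l i) ^ 2 + (t * l i) ^ 4) / 12 :=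
          norm_sum_le_of_le _ fun i _ => norm_cexp_taylor_three_le (t * l i)
      _ = _ := by
          rw [hm2, hm4, ← Finset.sum_div, Finset.sum_add_distrib]
          simp only [mul_pow, ← Finset.mul_sum]
          field_simp
  -- With `u = t² mom2 A` and `u² ≤ t⁴ mom4 A`, the case of negative `1 - u / 2` reduces to `(u -
  -- 4)² ≥ 0`; no restriction on `t` is needed.
  have hmain : ‖((1 - t ^ 2 * mom2 A / 2 : ℝ) : ℂ)‖ ≤
      1 - t ^ 2 * mom2 A / 2 + t ^ 4 * mom4 A / 8 := by
    rw [Complex.norm_real, Real.norm_eq_abs]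
    have h4 : (t ^ 2 * mom2 A) ^ 2 ≤ t ^ 4 * mom4 A := by
      rw [mul_pow, ← pow_mul]; exact mul_le_mul_of_nonneg_left hsq (Even.pow_nonneg (by decide) t)
    generalize t ^ 2 * mom2 A = u at *
    rw [abs_le]; constructor <;> nlinarith [sq_nonneg (u - 4), sq_nonneg u]
  rw [hdec]
  -- The constants are `5/12 = 1/2 - 1/12` and `5/24 = 1/8 + 1/12`.
  refine (norm_add_le _ _).trans ((add_le_add hmain hrem).trans ?_)
  refine le_trans (le_of_eq ?_) (Real.add_one_le_exp _)
  ring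

end Spectral

theorem mom2_eq_sum_norm_sq {A : Matrix n n ℂ} (hA : A.IsHermitian) :
    mom2 A = (∑ i, ∑ j, ‖A i j‖ ^ 2) / Fintype.card n := by
  have h : (A ^ 2).trace = ((∑ i, ∑ j, ‖A i j‖ ^ 2 : ℝ) : ℂ) := by
    rw [sq, Matrix.trace]
    push_cast
    refine Finset.sum_congr rfl fun i _ => ?_
    rw [Matrix.diag_apply, Matrix.mul_apply]
    refine Finset.sum_congr rfl fun j _ => ?_
    rw [← hA.apply j i, ← Complex.conj_mul', mul_comm]; rfl
  rw [mom2, ntr, h, ← Complex.ofReal_natCast, ← Complex.ofReal_div, Complex.ofReal_re]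

/-- Cauchy–Schwarz for the normalized Hilbert–Schmidt inner product, in which a unitary has norm
one. Having the root mean square here instead of the operator norm is what makes decoupling `k`
blocks cost only `√k`. -/
theorem norm_ntr_unitary_mul_le [Nonempty n] {U A : Matrix n n ℂ}
    (hU : U ∈ Matrix.unitaryGroup n ℂ) (hA : A.IsHermitian) :
    ‖ntr (U * A)‖ ≤ √(mom2 A) := by
  have hc : (0 : ℝ) < Fintype.card n := by exact_mod_cast Fintype.card_pos
  have hUn : ∑ i, ∑ j, ‖U i j‖ ^ 2 = Fintype.card n := by
    have h1 : (U * star U).trace = Fintype.card n := by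
      rw [Matrix.mem_unitaryGroup_iff.mp hU, Matrix.trace_one]
    have h2 : (U * star U).trace = ((∑ i, ∑ j, ‖U i j‖ ^ 2 : ℝ) : ℂ) := by
      rw [Matrix.trace]
      push_cast
      refine Finset.sum_congr rfl fun i _ => ?_
      rw [Matrix.diag_apply, Matrix.mul_apply]
      refine Finset.sum_congr rfl fun j _ => ?_
      rw [Matrix.star_apply, ← Complex.mul_conj']; rfl
    rw [h1] at h2
    exact_mod_cast h2.symm
  refine Real.le_sqrt_of_sq_le ?_
  rw [mom2_eq_sum_norm_sq hA, ntr, norm_div, Complex.norm_natCast, div_pow,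
    div_le_div_iff₀ (by positivity) hc]
  have htr : ‖(U * A).trace‖ ≤ ∑ p : n × n, ‖U p.1 p.2‖ * ‖A p.2 p.1‖ := by
    rw [Matrix.trace, Fintype.sum_prod_type]
    refine norm_sum_le_of_le _ fun i _ => ?_
    rw [Matrix.diag_apply, Matrix.mul_apply]
    exact norm_sum_le_of_le _ fun j _ => (norm_mul _ _).le
  have hcs := Finset.sum_mul_sq_le_sq_mul_sq Finset.univ
    (fun p : n × n => ‖U p.1 p.2‖) (fun p : n × n => ‖A p.2 p.1‖)
  rw [Fintype.sum_prod_type (fun p : n × n => ‖U p.1 p.2‖ ^ 2),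
    Fintype.sum_prod_type_right (fun p : n × n => ‖A p.2 p.1‖ ^ 2), hUn] at hcs
  have := pow_le_pow_left₀ (norm_nonneg _) htr 2
  calc _ ≤ (Fintype.card n * ∑ i, ∑ j, ‖A i j‖ ^ 2) * (Fintype.card n : ℝ) := by
        gcongr; exact this.trans hcs
    _ = _ := by ring

theorem hasDerivAt_evol (A : Matrix n n ℂ) (t : ℝ) :
    HasDerivAt (evol A) (evol A t * (Complex.I • A)) t := by
  let _ : NormedAlgebra ℚ (Matrix n n ℂ) := NormedAlgebra.restrictScalars ℚ ℂ _
  have h := hasDerivAt_exp_smul_const (𝕂 := ℝ) (Complex.I • A) t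
  have he : evol A = fun s : ℝ => NormedSpace.exp (s • (Complex.I • A)) := by
    funext s
    rw [evol, mul_comm, mul_smul, Complex.coe_smul]
  rw [he]
  exact h

/-- Removing a perturbation from the generator changes the characteristic function by at most
the time multiplied by the root mean square of the perturbation. -/
theorem norm_ntr_evol_sub_le [Nonempty n] {A B : Matrix n n ℂ} (hA : A.IsHermitian)
    (hB : B.IsHermitian) {t : ℝ} (ht : 0 ≤ t) :
    ‖ntr (evol A t) - ntr (evol B t)‖ ≤ t * √(mom2 (A - B)) := by
  let L : Matrix n n ℂ →L[ℝ] ℂ :=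
    LinearMap.toContinuousLinearMap
      { toFun := ntr, map_add' := ntr_add
        map_smul' := fun c X => by
          simpa using ntr_smul (c : ℂ) X }
  -- Duhamel interpolation from `exp (i t B)` at `s = 0` to `exp (i t A)` at `s = t`. By cyclicity
  -- the derivative is `i` times the normalized trace of a unitary times `A - B`.
  have hderiv : ∀ s : ℝ, HasDerivAt (fun s => ntr (evol A s * evol B (t - s)))
      (ntr (evol A s * (Complex.I • A) * evol B (t - s) +
        evol A s * (-(evol B (t - s) * (Complex.I • B))))) s := by
    intro s
    have h1 := hasDerivAt_evol A s
    have h2 : HasDerivAt (fun s => evol B (t - s)) (-(evol B (t - s) * (Complex.I • B))) s := by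
      have := (hasDerivAt_evol B (t - s)).scomp s ((hasDerivAt_id s).const_sub t)
      simp only [neg_smul, one_smul] at this
      exact this
    exact L.hasFDerivAt.comp_hasDerivAt s (h1.mul h2)
  have hB' : ∀ s, evol B s * (Complex.I • B) = (Complex.I • B) * evol B s := by
    intro s
    have : Commute B (evol B s) := by
      let _ : NormedAlgebra ℚ (Matrix n n ℂ) := NormedAlgebra.restrictScalars ℚ ℂ _
      exact ((Commute.refl B).smul_right _).exp_right
    rw [mul_smul_comm, smul_mul_assoc, this.eq]
  have hbound : ∀ s ∈ Set.Ico (0 : ℝ) t, ‖ntr (evol A s * (Complex.I • A) * evol B (t - s) +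
        evol A s * (-(evol B (t - s) * (Complex.I • B))))‖ ≤ √(mom2 (A - B)) := by
    intro s _
    have : ntr (evol A s * (Complex.I • A) * evol B (t - s) +
        evol A s * (-(evol B (t - s) * (Complex.I • B)))) =
        Complex.I * ntr ((evol B (t - s) * evol A s) * (A - B)) := by
      rw [hB', ntr_mul_comm (evol B (t - s) * evol A s), ← mul_assoc,
        ntr_mul_comm _ (evol A s), ← ntr_smul]
      congr 1
      simp only [mul_smul_comm, smul_mul_assoc, mul_neg, mul_sub, sub_mul, mul_assoc, smul_sub]
      abel
    rw [this, norm_mul, Complex.norm_I, one_mul]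
    exact norm_ntr_unitary_mul_le
      (mul_mem (evol_hermitian_unitary hB _) (evol_hermitian_unitary hA _)) (hA.sub hB)
  have h := norm_image_sub_le_of_norm_deriv_le_segment' (a := 0) (b := t)
    (fun s _ => (hderiv s).hasDerivWithinAt) hbound t ⟨ht, le_rfl⟩
  have e0 : ∀ X : Matrix n n ℂ, evol X 0 = 1 := fun X => by simp [evol]
  simp only [sub_self, sub_zero, e0, mul_one, one_mul] at h
  linarith [mul_comm t (√(mom2 (A - B)))]

/-- Parallelogram law, dropping the nonnegative second moment of `A - B`. -/
theorem mom2_add_le {A B : Matrix n n ℂ} (hA : A.IsHermitian) (hB : B.IsHermitian) :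
    mom2 (A + B) ≤ 2 * mom2 A + 2 * mom2 B := by
  have h := mom2_nonneg (hA.sub hB)
  have e : ntr ((A + B) ^ 2) + ntr ((A - B) ^ 2) = 2 * ntr (A ^ 2) + 2 * ntr (B ^ 2) := by
    rw [← ntr_add, ← ntr_smul, ← ntr_smul, ← ntr_add]
    congr 1
    rw [two_smul, two_smul]
    noncomm_ring
  have e' := congrArg Complex.re e
  simp at e'
  unfold mom2 at *
  linarith

end NormalizedTrace

/-! ### Operators supported on a region, and independence of complementary regions. -/

section Support

open scoped Kronecker
variable {D M : ℕ} {d : Site D M → ℕ}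

/-- Splitting a configuration into its restrictions to a region and to the complement. -/
noncomputable def splitConfig (d : Site D M → ℕ) (S : Set (Site D M)) :
    Config d ≃ (∀ j : S, Fin (d j)) × (∀ j : (Sᶜ : Set (Site D M)), Fin (d j)) :=
  open scoped Classical in Equiv.piEquivPiSubtypeProd (· ∈ S) (fun j => Fin (d j))

open scoped Classical in
theorem actsOn_iff_kronecker_one {S : Set (Site D M)} {A : Operator d} :
    ActsOn S A ↔ ∃ B : Matrix (∀ j : S, Fin (d j)) (∀ j : S, Fin (d j)) ℂ,
      A = (B ⊗ₖ (1 : Matrix (∀ j : (Sᶜ : Set (Site D M)), Fin (d j)) _ ℂ)).submatrix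
        (splitConfig d S) (splitConfig d S) := by
  have hout : ∀ x y : Config d, (splitConfig d S x).2 = (splitConfig d S y).2 ↔
      ∀ j, j ∉ S → x j = y j := by
    intro x y
    rw [funext_iff, Subtype.forall]
    rfl
  refine exists_congr fun B => ⟨fun h => ?_, fun h x y => ⟨fun hxy => ?_, fun hxy => ?_⟩⟩
  · ext x y
    rw [Matrix.submatrix_apply, Matrix.kroneckerMap_apply, Matrix.one_apply]
    by_cases hxy : ∀ j, j ∉ S → x j = y j
    · rw [(h x y).1 hxy, if_pos ((hout x y).2 hxy), mul_one]; rfl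
    · rw [(h x y).2 (by push Not at hxy; exact hxy), if_neg (fun h' => hxy ((hout x y).1 h')),
        mul_zero]
  · rw [h, Matrix.submatrix_apply, Matrix.kroneckerMap_apply, Matrix.one_apply,
      if_pos ((hout x y).2 hxy), mul_one]; rfl
  · rw [h, Matrix.submatrix_apply, Matrix.kroneckerMap_apply, Matrix.one_apply, if_neg, mul_zero]
    rw [hout]
    push Not
    exact hxy

open scoped Classical in
theorem actsOn_compl_iff_one_kronecker {S : Set (Site D M)} {A : Operator d} :
    ActsOn Sᶜ A ↔ ∃ B : Matrix (∀ j : (Sᶜ : Set (Site D M)), Fin (d j)) _ ℂ,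
      A = ((1 : Matrix (∀ j : S, Fin (d j)) _ ℂ) ⊗ₖ B).submatrix
        (splitConfig d S) (splitConfig d S) := by
  have hout : ∀ x y : Config d, (splitConfig d S x).1 = (splitConfig d S y).1 ↔
      ∀ j, j ∉ Sᶜ → x j = y j := by
    intro x y
    rw [funext_iff, Subtype.forall]
    simp only [Set.mem_compl_iff, not_not]
    rfl
  refine exists_congr fun B => ⟨fun h => ?_, fun h x y => ⟨fun hxy => ?_, fun hxy => ?_⟩⟩
  · ext x y
    rw [Matrix.submatrix_apply, Matrix.kroneckerMap_apply, Matrix.one_apply]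
    by_cases hxy : ∀ j, j ∉ Sᶜ → x j = y j
    · rw [(h x y).1 hxy, if_pos ((hout x y).2 hxy), one_mul]; rfl
    · rw [(h x y).2 (by push Not at hxy; exact hxy), if_neg (fun h' => hxy ((hout x y).1 h')),
        zero_mul]
  · rw [h, Matrix.submatrix_apply, Matrix.kroneckerMap_apply, Matrix.one_apply,
      if_pos ((hout x y).2 hxy), one_mul]; rfl
  · rw [h, Matrix.submatrix_apply, Matrix.kroneckerMap_apply, Matrix.one_apply, if_neg, zero_mul]
    rw [hout]
    push Not
    exact hxy

/-- The algebra of operators acting non-trivially only on the region `S`. -/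
noncomputable def regionAlgebra (d : Site D M → ℕ) (S : Set (Site D M)) :
    Subalgebra ℂ (Operator d) where
  carrier := {A | ActsOn S A}
  mul_mem' := by
    classical
    intro A B hA hB
    obtain ⟨A', rfl⟩ := actsOn_iff_kronecker_one.1 hA
    obtain ⟨B', rfl⟩ := actsOn_iff_kronecker_one.1 hB
    refine actsOn_iff_kronecker_one.2 ⟨A' * B', ?_⟩
    rw [Matrix.submatrix_mul_equiv, ← Matrix.mul_kronecker_mul, one_mul]
  add_mem' := by
    classical
    intro A B hA hB
    obtain ⟨A', rfl⟩ := actsOn_iff_kronecker_one.1 hA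
    obtain ⟨B', rfl⟩ := actsOn_iff_kronecker_one.1 hB
    refine actsOn_iff_kronecker_one.2 ⟨A' + B', ?_⟩
    rw [Matrix.add_kronecker]; rfl
  algebraMap_mem' := by
    classical
    intro c
    refine actsOn_iff_kronecker_one.2 ⟨c • 1, ?_⟩
    rw [Matrix.smul_kronecker, Matrix.one_kronecker_one, Matrix.submatrix_smul, Pi.smul_apply,
      Pi.smul_apply, Matrix.submatrix_one_equiv, Algebra.algebraMap_eq_smul_one]

theorem ActsOn.mul {S : Set (Site D M)} {A B : Operator d} (hA : ActsOn S A) (hB : ActsOn S B) :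
    ActsOn S (A * B) := (regionAlgebra d S).mul_mem hA hB

theorem ActsOn.add {S : Set (Site D M)} {A B : Operator d} (hA : ActsOn S A) (hB : ActsOn S B) :
    ActsOn S (A + B) := (regionAlgebra d S).add_mem hA hB

theorem ActsOn.sub {S : Set (Site D M)} {A B : Operator d} (hA : ActsOn S A) (hB : ActsOn S B) :
    ActsOn S (A - B) := (regionAlgebra d S).sub_mem hA hB

theorem ActsOn.smul {S : Set (Site D M)} {A : Operator d} (hA : ActsOn S A) (c : ℂ) :
    ActsOn S (c • A) := (regionAlgebra d S).smul_mem hA c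

theorem actsOn_one (S : Set (Site D M)) : ActsOn S (1 : Operator d) :=
  (regionAlgebra d S).one_mem

theorem actsOn_sum {ι : Type*} {S : Set (Site D M)} {s : Finset ι} {A : ι → Operator d}
    (hA : ∀ i ∈ s, ActsOn S (A i)) : ActsOn S (∑ i ∈ s, A i) :=
  (regionAlgebra d S).sum_mem hA

theorem ActsOn.conjTranspose {S : Set (Site D M)} {A : Operator d} (hA : ActsOn S A) :
    ActsOn S A.conjTranspose := by
  classical
  obtain ⟨A', rfl⟩ := actsOn_iff_kronecker_one.1 hA
  refine actsOn_iff_kronecker_one.2 ⟨A'.conjTranspose, ?_⟩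
  rw [Matrix.conjTranspose_submatrix, Matrix.conjTranspose_kronecker, Matrix.conjTranspose_one]

/-- The region algebra is finite-dimensional, hence closed, and contains the partial sums of the
exponential series. -/
theorem ActsOn.evol {S : Set (Site D M)} {A : Operator d} (hA : ActsOn S A) (t : ℝ) :
    ActsOn S (evol A t) := by
  let _ : NormedAlgebra ℚ (Operator d) := NormedAlgebra.restrictScalars ℚ ℂ _
  have hclosed : IsClosed ((regionAlgebra d S).toSubmodule : Set (Operator d)) :=
    Submodule.closed_of_finiteDimensional _
  have hsum := NormedSpace.exp_series_hasSum_exp' (𝕂 := ℂ) ((Complex.I * (t : ℂ)) • A)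
  exact hclosed.mem_of_tendsto hsum (Filter.Eventually.of_forall fun s =>
    (regionAlgebra d S).sum_mem fun i _ => (regionAlgebra d S).smul_mem
      ((regionAlgebra d S).pow_mem ((regionAlgebra d S).smul_mem hA _) i) _)

theorem ActsOn.mono {S T : Set (Site D M)} (hST : S ⊆ T) {A : Operator d} (hA : ActsOn S A) :
    ActsOn T A := by
  classical
  obtain ⟨B, hB⟩ := hA
  -- The witness is `B` tensored with the identity on `T \ S`.
  refine ⟨fun u v => if ∀ j : T, (j : Site D M) ∉ S → u j = v j then
    B (fun j => u ⟨j, hST j.2⟩) (fun j => v ⟨j, hST j.2⟩) else 0, fun x y => ⟨fun h => ?_, ?_⟩⟩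
  · beta_reduce
    split_ifs with h'
    · refine (hB x y).1 fun j hj => ?_
      by_cases hT : j ∈ T
      · exact h' ⟨j, hT⟩ hj
      · exact h j hT
    · push Not at h'
      obtain ⟨j, hj, hne⟩ := h'
      exact (hB x y).2 ⟨j, hj, hne⟩
  · rintro ⟨j, hj, hne⟩
    exact (hB x y).2 ⟨j, fun h => hj (hST h), hne⟩

theorem commute_of_actsOn_compl {S : Set (Site D M)} {A B : Operator d} (hA : ActsOn S A)
    (hB : ActsOn Sᶜ B) : Commute A B := by
  classical
  obtain ⟨A', rfl⟩ := actsOn_iff_kronecker_one.1 hA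
  obtain ⟨B', rfl⟩ := actsOn_compl_iff_one_kronecker.1 hB
  rw [Commute, SemiconjBy, Matrix.submatrix_mul_equiv, Matrix.submatrix_mul_equiv,
    ← Matrix.mul_kronecker_mul, ← Matrix.mul_kronecker_mul]
  simp

/-- The maximally mixed state is a product state: traces and dimensions both factorize over the
tensor product. -/
theorem ntr_mul_of_actsOn_compl [Nonempty (Config d)] {S : Set (Site D M)} {A B : Operator d}
    (hA : ActsOn S A) (hB : ActsOn Sᶜ B) : ntr (A * B) = ntr A * ntr B := by
  classical
  obtain ⟨A', rfl⟩ := actsOn_iff_kronecker_one.1 hA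
  obtain ⟨B', rfl⟩ := actsOn_compl_iff_one_kronecker.1 hB
  have htr : ∀ X : Matrix ((∀ j : S, Fin (d j)) × (∀ j : (Sᶜ : Set (Site D M)), Fin (d j))) _ ℂ,
      (X.submatrix (splitConfig d S) (splitConfig d S)).trace = X.trace := fun X =>
    (splitConfig d S).sum_comp fun p => X p p
  have hcard := Fintype.card_congr (splitConfig d S)
  rw [Fintype.card_prod] at hcard
  have hne : (Fintype.card (Config d) : ℂ) ≠ 0 := by exact_mod_cast Fintype.card_ne_zero
  have hcard' : (Fintype.card (Config d) : ℂ) = (Fintype.card (∀ j : S, Fin (d j)) : ℂ) *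
      (Fintype.card (∀ j : (Sᶜ : Set (Site D M)), Fin (d j)) : ℂ) := by exact_mod_cast hcard
  rw [Matrix.submatrix_mul_equiv, ← Matrix.mul_kronecker_mul, mul_one, one_mul, ntr, ntr, ntr,
    htr, htr, htr, Matrix.trace_kronecker, Matrix.trace_kronecker, Matrix.trace_kronecker,
    Matrix.trace_one, Matrix.trace_one]
  rw [hcard'] at hne ⊢
  field_simp [left_ne_zero_of_mul hne, right_ne_zero_of_mul hne]

theorem ntr_mul_eq_zero_of_disjoint [Nonempty (Config d)] {S T : Set (Site D M)}
    (hST : Disjoint S T) {A B : Operator d} (hA : ActsOn S A) (hB : ActsOn T B)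
    (h0 : ntr A = 0) : ntr (A * B) = 0 := by
  rw [ntr_mul_of_actsOn_compl hA (hB.mono hST.subset_compl_left), h0, zero_mul]

theorem ntr_evol_add_of_actsOn_compl [Nonempty (Config d)] {S : Set (Site D M)}
    {A B : Operator d} (hA : ActsOn S A) (hB : ActsOn Sᶜ B) (t : ℝ) :
    ntr (evol (A + B) t) = ntr (evol A t) * ntr (evol B t) := by
  rw [← ntr_mul_of_actsOn_compl (hA.evol t) (hB.evol t), evol, smul_add,
    Matrix.exp_add_of_commute]
  · rfl
  · exact ((commute_of_actsOn_compl hA hB).smul_left _).smul_right _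

/-- The characteristic function of a sum of mutually decoupled blocks and a remainder. -/
theorem norm_ntr_evol_sum_add_le [Nonempty (Config d)] {ι : Type*} [DecidableEq ι]
    (s : Finset ι) (Q : ι → Set (Site D M)) (A : ι → Operator d) (B : Operator d)
    (hA : ∀ b, ActsOn (Q b) (A b)) (hA' : ∀ b c, b ≠ c → ActsOn (Q b)ᶜ (A c))
    (hB : ∀ b ∈ s, ActsOn (Q b)ᶜ B) (hBh : B.IsHermitian) (t : ℝ) :
    ‖ntr (evol (∑ b ∈ s, A b + B) t)‖ ≤ ∏ b ∈ s, ‖ntr (evol (A b) t)‖ := by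
  induction s using Finset.induction_on with
  -- Once all blocks are split off, only the evolution of `B` is left, and its normalized trace has
  -- modulus at most one.
  | empty => simpa using norm_ntr_evol_le_one hBh t
  | insert b s hb ih =>
    rw [Finset.sum_insert hb, Finset.prod_insert hb, add_assoc,
      ntr_evol_add_of_actsOn_compl (hA b), norm_mul]
    · exact mul_le_mul_of_nonneg_left (ih fun c hc => hB c (Finset.mem_insert_of_mem hc))
        (norm_nonneg _)
    · refine ActsOn.add (actsOn_sum fun c hc => hA' b c ?_) (hB b (Finset.mem_insert_self b s))
      rintro rfl
      exact hb hc

theorem mom2_sum_of_disjoint [Nonempty (Config d)] {ι : Type*} [DecidableEq ι]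
    (s : Finset ι) (Q : ι → Set (Site D M)) (A : ι → Operator d)
    (hA : ∀ b, ActsOn (Q b) (A b)) (hA' : ∀ b c, b ≠ c → ActsOn (Q b)ᶜ (A c))
    (h0 : ∀ b, ntr (A b) = 0) : mom2 (∑ b ∈ s, A b) = ∑ b ∈ s, mom2 (A b) := by
  simp only [mom2]
  rw [sq, Finset.sum_mul_sum, ntr_sum, Complex.re_sum]
  refine Finset.sum_congr rfl fun b hb => ?_
  rw [ntr_sum, Finset.sum_eq_single_of_mem b hb, sq]
  intro c _ hcb
  rw [ntr_mul_of_actsOn_compl (hA b) (hA' b c hcb.symm), h0, zero_mul]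

end Support

/-! ### Second and fourth moments of sums of local terms. -/

section Moments

variable {D M : ℕ} {d : Site D M → ℕ}

/-- A family of centered operators of norm at most `g`, each acting on its own region, such that
every region meets at most `Δ` regions of the family. -/
structure IsBoundedFamily {ι : Type*} [Fintype ι] (S : ι → Set (Site D M)) (g : ℝ) (Δ : ℕ)
    (a : ι → Operator d) : Prop where
  actsOn : ∀ i, ActsOn (S i) (a i)
  ntr_eq_zero : ∀ i, ntr (a i) = 0
  isHermitian : ∀ i, (a i).IsHermitian
  norm_le : ∀ i, ‖a i‖ ≤ g
  ncard_le : ∀ i, {j | ¬ Disjoint (S i) (S j)}.ncard ≤ Δ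

/-- The indicator of two regions having a point in common. -/
noncomputable def meet {ι : Type*} (S : ι → Set (Site D M)) (i j : ι) : ℝ :=
  open scoped Classical in if Disjoint (S i) (S j) then 0 else 1

section Meet

variable {ι : Type*} {S : ι → Set (Site D M)}

theorem meet_nonneg (i j : ι) : 0 ≤ meet S i j := by
  unfold meet; split_ifs <;> norm_num

theorem meet_of_disjoint {i j : ι} (h : Disjoint (S i) (S j)) : meet S i j = 0 := if_pos h

theorem meet_of_not_disjoint {i j : ι} (h : ¬ Disjoint (S i) (S j)) : meet S i j = 1 := if_neg h

theorem meet_comm (i j : ι) : meet S i j = meet S j i := by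
  by_cases h : Disjoint (S i) (S j)
  · simp [meet, h, h.symm]
  · rw [meet_of_not_disjoint h, meet_of_not_disjoint (fun h' => h h'.symm)]

theorem meet_mul_nonneg (i j k l : ι) : 0 ≤ meet S i j * meet S k l :=
  mul_nonneg (meet_nonneg _ _) (meet_nonneg _ _)

/-- If none of four regions is disjoint from all the others, then enough of them meet. -/
theorem one_le_meet_of_not_isolated {i j k l : ι}
    (hi : ¬ (Disjoint (S i) (S j) ∧ Disjoint (S i) (S k) ∧ Disjoint (S i) (S l)))
    (hj : ¬ (Disjoint (S j) (S k) ∧ Disjoint (S j) (S l) ∧ Disjoint (S j) (S i)))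
    (hk : ¬ (Disjoint (S k) (S l) ∧ Disjoint (S k) (S i) ∧ Disjoint (S k) (S j)))
    (hl : ¬ (Disjoint (S l) (S i) ∧ Disjoint (S l) (S j) ∧ Disjoint (S l) (S k))) :
    1 ≤ meet S i j * meet S k l + meet S i k * meet S j l + meet S i l * meet S j k +
      meet S i k * meet S i l + meet S j k * meet S j l + meet S i k * meet S k l +
      meet S i l * meet S l k := by
  simp only [disjoint_comm (a := S j) (b := S i), disjoint_comm (a := S k) (b := S i),
    disjoint_comm (a := S l) (b := S i), disjoint_comm (a := S k) (b := S j),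
    disjoint_comm (a := S l) (b := S j), disjoint_comm (a := S l) (b := S k)] at hi hj hk hl
  rw [meet_comm l k]
  -- A graph on four vertices without isolated vertex contains a perfect matching or a spanning
  -- star. The seven products are the three matchings and, for each centre, two edges of its star;
  -- all `2⁶` graphs are checked.
  by_cases h1 : Disjoint (S i) (S j) <;> by_cases h2 : Disjoint (S i) (S k) <;>
    by_cases h3 : Disjoint (S i) (S l) <;> by_cases h4 : Disjoint (S j) (S k) <;>
    by_cases h5 : Disjoint (S j) (S l) <;> by_cases h6 : Disjoint (S k) (S l) <;>
    simp only [h1, h2, h3, h4, h5, h6, and_self, and_true, and_false, not_true_eq_false,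
      not_false_eq_true, meet, if_true, if_false] at hi hj hk hl ⊢ <;> norm_num

theorem sum_meet_le [Fintype ι] {Δ : ℕ} {i : ι} (h : {j | ¬ Disjoint (S i) (S j)}.ncard ≤ Δ)
    (F : Finset ι) : ∑ j ∈ F, meet S i j ≤ Δ := by
  classical
  calc ∑ j ∈ F, meet S i j ≤ ∑ j, meet S i j :=
        Finset.sum_le_sum_of_subset_of_nonneg (Finset.subset_univ F) fun j _ _ => meet_nonneg i j
    _ = ({j | ¬ Disjoint (S i) (S j)}.ncard : ℝ) := by
        rw [Set.ncard_eq_toFinset_card', Set.toFinset_ofPred, Finset.card_filter]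
        push_cast
        refine Finset.sum_congr rfl fun j _ => ?_
        by_cases hd : Disjoint (S i) (S j) <;> simp [meet, hd]
    _ ≤ Δ := by exact_mod_cast h

theorem sum_meet_mul_le [Fintype ι] {Δ : ℕ} (h : ∀ i, {j | ¬ Disjoint (S i) (S j)}.ncard ≤ Δ)
    (F : Finset ι) {c : ℝ} {f : ι → ℝ} (hf : ∀ j, f j ≤ c) (hc : 0 ≤ c) (i : ι) :
    ∑ j ∈ F, meet S i j * f j ≤ Δ * c := by
  calc ∑ j ∈ F, meet S i j * f j ≤ ∑ j ∈ F, meet S i j * c :=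
        Finset.sum_le_sum fun j _ => mul_le_mul_of_nonneg_left (hf j) (meet_nonneg i j)
    _ = (∑ j ∈ F, meet S i j) * c := by rw [Finset.sum_mul]
    _ ≤ Δ * c := mul_le_mul_of_nonneg_right (sum_meet_le (h i) F) hc

/-- In six of the products, fixing `i` and `j` leaves at most `Δ²` choices of `k` and `l`. The
product pairing `i` with `j` and `k` with `l` leaves `k` free, and is the square of a double sum of
size at most `Δ * F.card`. -/
theorem sum_quadruple_meet_le [Fintype ι] {Δ : ℕ}
    (h : ∀ i, {j | ¬ Disjoint (S i) (S j)}.ncard ≤ Δ) (F : Finset ι) :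
    ∑ i ∈ F, ∑ j ∈ F, ∑ k ∈ F, ∑ l ∈ F, (meet S i j * meet S k l + meet S i k * meet S j l +
      meet S i l * meet S j k + meet S i k * meet S i l + meet S j k * meet S j l +
      meet S i k * meet S k l + meet S i l * meet S l k) ≤ 7 * (Δ * F.card : ℝ) ^ 2 := by
  have hΔ : (0 : ℝ) ≤ Δ := Nat.cast_nonneg _
  have s1 : ∀ i, ∑ j ∈ F, meet S i j ≤ Δ := fun i => sum_meet_le (h i) F
  have s0 : ∀ i, 0 ≤ ∑ j ∈ F, meet S i j := fun i => Finset.sum_nonneg fun j _ => meet_nonneg i j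
  have hprod : ∀ i j, (∑ k ∈ F, meet S i k) * (∑ l ∈ F, meet S j l) ≤ (Δ : ℝ) ^ 2 := fun i j => by
    rw [sq]; exact mul_le_mul (s1 i) (s1 j) (s0 j) hΔ
  have hchain : ∀ i, ∑ k ∈ F, meet S i k * (∑ l ∈ F, meet S k l) ≤ (Δ : ℝ) ^ 2 := fun i => by
    rw [sq]; exact sum_meet_mul_le h F s1 hΔ i
  have hin : ∀ i j, ∑ k ∈ F, ∑ l ∈ F, (meet S i k * meet S j l + meet S i l * meet S j k +
      meet S i k * meet S i l + meet S j k * meet S j l +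
      meet S i k * meet S k l + meet S i l * meet S l k) ≤ 6 * (Δ : ℝ) ^ 2 := by
    intro i j
    have e1 := hprod i j
    have e2 := hprod i i
    have e3 := hprod j j
    have e4 := hchain i
    have e5 : ∑ k ∈ F, ∑ l ∈ F, meet S i l * meet S j k ≤ (Δ : ℝ) ^ 2 := by
      rw [Finset.sum_comm, ← Finset.sum_mul_sum]; exact e1
    have e6 : ∑ k ∈ F, ∑ l ∈ F, meet S i l * meet S l k ≤ (Δ : ℝ) ^ 2 := by
      rw [Finset.sum_comm]; simpa only [Finset.mul_sum] using e4
    rw [Finset.sum_mul_sum] at e1 e2 e3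
    simp only [Finset.mul_sum] at e4
    simp only [Finset.sum_add_distrib]
    linarith
  have hfirst : ∑ i ∈ F, ∑ j ∈ F, ∑ k ∈ F, ∑ l ∈ F, meet S i j * meet S k l ≤
      (Δ * F.card : ℝ) ^ 2 := by
    have hW : ∑ i ∈ F, ∑ j ∈ F, meet S i j ≤ Δ * F.card := by
      refine (Finset.sum_le_sum fun i _ => s1 i).trans (le_of_eq ?_)
      rw [Finset.sum_const, nsmul_eq_mul, mul_comm]
    have hW0 : 0 ≤ ∑ i ∈ F, ∑ j ∈ F, meet S i j := Finset.sum_nonneg fun i _ => s0 i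
    simp only [← Finset.mul_sum, ← Finset.sum_mul]
    rw [sq]
    exact mul_le_mul hW hW hW0 (by positivity)
  calc _ = ∑ i ∈ F, ∑ j ∈ F, ∑ k ∈ F, ∑ l ∈ F, meet S i j * meet S k l +
        ∑ i ∈ F, ∑ j ∈ F, ∑ k ∈ F, ∑ l ∈ F, (meet S i k * meet S j l + meet S i l * meet S j k +
          meet S i k * meet S i l + meet S j k * meet S j l +
          meet S i k * meet S k l + meet S i l * meet S l k) := by
        simp only [← Finset.sum_add_distrib, add_assoc]
    _ ≤ (Δ * F.card : ℝ) ^ 2 + ∑ _i ∈ F, ∑ _j ∈ F, 6 * (Δ : ℝ) ^ 2 :=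
        add_le_add hfirst (Finset.sum_le_sum fun i _ => Finset.sum_le_sum fun j _ => hin i j)
    _ = _ := by simp only [Finset.sum_const, nsmul_eq_mul]; ring

end Meet

variable [Nonempty (Config d)] {ι : Type*} [Fintype ι] {S : ι → Set (Site D M)} {g : ℝ} {Δ : ℕ}
  {a : ι → Operator d}

theorem ntr_mul_four_eq_zero {i j k l : ι} (ha : IsBoundedFamily S g Δ a)
    (h : Disjoint (S i) (S j) ∧ Disjoint (S i) (S k) ∧ Disjoint (S i) (S l)) :
    ntr (a i * (a j * a k * a l)) = 0 :=
  ntr_mul_eq_zero_of_disjoint disjoint_compl_right (ha.actsOn i)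
    ((((ha.actsOn j).mono h.1.subset_compl_left).mul
      ((ha.actsOn k).mono h.2.1.subset_compl_left)).mul
        ((ha.actsOn l).mono h.2.2.subset_compl_left)) (ha.ntr_eq_zero i)

theorem norm_ntr_mul_le (ha : IsBoundedFamily S g Δ a) (i j : ι) :
    ‖ntr (a i * a j)‖ ≤ g ^ 2 * meet S i j := by
  by_cases h : Disjoint (S i) (S j)
  · rw [ntr_mul_eq_zero_of_disjoint h (ha.actsOn i) (ha.actsOn j) (ha.ntr_eq_zero i),
      meet_of_disjoint h]
    simp
  · rw [meet_of_not_disjoint h, mul_one, sq]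
    exact (norm_ntr_le _).trans ((norm_mul_le _ _).trans
      (mul_le_mul (ha.norm_le i) (ha.norm_le j) (norm_nonneg _)
        ((norm_nonneg _).trans (ha.norm_le i))))

/-- An isolated factor can be moved to the front by cyclicity and then factors out with zero trace;
otherwise the bracket is at least one and norms suffice. -/
theorem norm_ntr_mul_four_le (ha : IsBoundedFamily S g Δ a) (i j k l : ι) :
    ‖ntr (a i * a j * (a k * a l))‖ ≤ g ^ 4 * (meet S i j * meet S k l +
      meet S i k * meet S j l + meet S i l * meet S j k + meet S i k * meet S i l +
      meet S j k * meet S j l + meet S i k * meet S k l + meet S i l * meet S l k) := by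
  have hg : 0 ≤ g := (norm_nonneg _).trans (ha.norm_le i)
  have hrhs : 0 ≤ g ^ 4 * (meet S i j * meet S k l +
      meet S i k * meet S j l + meet S i l * meet S j k + meet S i k * meet S i l +
      meet S j k * meet S j l + meet S i k * meet S k l + meet S i l * meet S l k) := by
    have := @meet_mul_nonneg D M ι S
    refine mul_nonneg (by positivity) ?_
    linarith [this i j k l, this i k j l, this i l j k, this i k i l, this j k j l, this i k k l,
      this i l l k]
  have e1 : ntr (a i * a j * (a k * a l)) = ntr (a i * (a j * a k * a l)) := by
    simp only [mul_assoc]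
  have e2 : ntr (a i * a j * (a k * a l)) = ntr (a j * (a k * a l * a i)) := by
    rw [mul_assoc (a i), ntr_mul_comm]; simp only [mul_assoc]
  have e3 : ntr (a i * a j * (a k * a l)) = ntr (a k * (a l * a i * a j)) := by
    rw [ntr_mul_comm]; simp only [mul_assoc]
  have e4 : ntr (a i * a j * (a k * a l)) = ntr (a l * (a i * a j * a k)) := by
    rw [← mul_assoc, ntr_mul_comm]
  by_cases hi : Disjoint (S i) (S j) ∧ Disjoint (S i) (S k) ∧ Disjoint (S i) (S l)
  · rwa [e1, ntr_mul_four_eq_zero ha hi, norm_zero]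
  by_cases hj : Disjoint (S j) (S k) ∧ Disjoint (S j) (S l) ∧ Disjoint (S j) (S i)
  · rwa [e2, ntr_mul_four_eq_zero ha hj, norm_zero]
  by_cases hk : Disjoint (S k) (S l) ∧ Disjoint (S k) (S i) ∧ Disjoint (S k) (S j)
  · rwa [e3, ntr_mul_four_eq_zero ha hk, norm_zero]
  by_cases hl : Disjoint (S l) (S i) ∧ Disjoint (S l) (S j) ∧ Disjoint (S l) (S k)
  · rwa [e4, ntr_mul_four_eq_zero ha hl, norm_zero]
  have hone := one_le_meet_of_not_isolated hi hj hk hl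
  calc ‖ntr (a i * a j * (a k * a l))‖ ≤ ‖a i * a j * (a k * a l)‖ := norm_ntr_le _
    _ ≤ (‖a i‖ * ‖a j‖) * (‖a k‖ * ‖a l‖) :=
        (norm_mul_le _ _).trans (mul_le_mul (norm_mul_le _ _) (norm_mul_le _ _) (norm_nonneg _)
          (by positivity))
    _ ≤ (g * g) * (g * g) := by gcongr <;> exact ha.norm_le _
    _ = g ^ 4 * 1 := by ring
    _ ≤ _ := mul_le_mul_of_nonneg_left hone (by positivity)

theorem mom2_sum_le (ha : IsBoundedFamily S g Δ a) (F : Finset ι) :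
    mom2 (∑ i ∈ F, a i) ≤ Δ * g ^ 2 * F.card := by
  rw [mom2, sq, Finset.sum_mul_sum]
  simp only [ntr_sum]
  refine (Complex.re_le_norm _).trans ?_
  calc _ ≤ ∑ i ∈ F, ∑ j ∈ F, g ^ 2 * meet S i j :=
        norm_sum_le_of_le _ fun i _ => norm_sum_le_of_le _ fun j _ => norm_ntr_mul_le ha i j
    _ ≤ ∑ _i ∈ F, g ^ 2 * Δ := Finset.sum_le_sum fun i _ => by
        rw [← Finset.mul_sum]
        exact mul_le_mul_of_nonneg_left (sum_meet_le (ha.ncard_le i) F) (sq_nonneg g)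
    _ = _ := by rw [Finset.sum_const, nsmul_eq_mul]; ring

theorem mom4_sum_le (ha : IsBoundedFamily S g Δ a) (F : Finset ι) :
    mom4 (∑ i ∈ F, a i) ≤ 7 * g ^ 4 * (Δ * F.card) ^ 2 := by
  have hexp : (∑ i ∈ F, a i) ^ 4 =
      ∑ i ∈ F, ∑ j ∈ F, ∑ k ∈ F, ∑ l ∈ F, a i * a j * (a k * a l) := by
    rw [show (∑ i ∈ F, a i) ^ 4 = (∑ i ∈ F, a i) * (∑ i ∈ F, a i) *
      ((∑ i ∈ F, a i) * (∑ i ∈ F, a i)) by noncomm_ring, Finset.sum_mul_sum]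
    rw [Finset.sum_mul]
    refine Finset.sum_congr rfl fun i _ => ?_
    rw [Finset.sum_mul]
    refine Finset.sum_congr rfl fun j _ => ?_
    rw [Finset.mul_sum]
    exact Finset.sum_congr rfl fun k _ => Finset.mul_sum _ _ _
  rw [mom4, hexp]
  simp only [ntr_sum]
  refine (Complex.re_le_norm _).trans ?_
  calc _ ≤ ∑ i ∈ F, ∑ j ∈ F, ∑ k ∈ F, ∑ l ∈ F, g ^ 4 * (meet S i j * meet S k l +
      meet S i k * meet S j l + meet S i l * meet S j k + meet S i k * meet S i l +
      meet S j k * meet S j l + meet S i k * meet S k l + meet S i l * meet S l k) :=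
        norm_sum_le_of_le _ fun i _ => norm_sum_le_of_le _ fun j _ =>
          norm_sum_le_of_le _ fun k _ => norm_sum_le_of_le _ fun l _ =>
            norm_ntr_mul_four_le ha i j k l
    _ ≤ g ^ 4 * (7 * (Δ * F.card) ^ 2) := by
        simp only [← Finset.mul_sum]
        exact mul_le_mul_of_nonneg_left (sum_quadruple_meet_le ha.ncard_le F)
          (Even.pow_nonneg (by decide) g)
    _ = _ := by ring

end Moments

/-! ### Balls and slabs in the lattice. -/

section Geometry

variable {D M : ℕ}

/-- The sites at distance at most `R` from `i`. -/
def ball (bc : Fin D → Bool) (R : ℕ) (i : Site D M) : Set (Site D M) := {j | siteDist bc i j ≤ R}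

theorem coordDist_comm (p : Bool) (a b : Fin M) : coordDist p a b = coordDist p b a := by
  have h : ((a : ℤ) - b).natAbs = ((b : ℤ) - a).natAbs := by omega
  simp only [coordDist, h]

theorem siteDist_comm (bc : Fin D → Bool) (i j : Site D M) : siteDist bc i j = siteDist bc j i :=
  Finset.sum_congr rfl fun _ _ => coordDist_comm _ _ _

theorem coordDist_le_siteDist (bc : Fin D → Bool) (i j : Site D M) (δ : Fin D) :
    coordDist (bc δ) (i δ) (j δ) ≤ siteDist bc i j :=
  Finset.single_le_sum (f := fun δ => coordDist (bc δ) (i δ) (j δ)) (fun _ _ => Nat.zero_le _)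
    (Finset.mem_univ δ)

/-- The second alternative is a path across the periodic seam; this form treats both boundary
conditions at once. -/
theorem near_or_far_of_coordDist_le {p : Bool} {a b : Fin M} {R : ℕ} (h : coordDist p a b ≤ R) :
    ((a : ℤ) - b).natAbs ≤ R ∨ M ≤ ((a : ℤ) - b).natAbs + R := by
  unfold coordDist at h
  dsimp only at h
  split_ifs at h <;> omega

theorem card_coordDist_le (p : Bool) (a : Fin M) (R : ℕ) :
    (Finset.univ.filter fun b => coordDist p a b ≤ R).card ≤ 4 * R + 1 := by
  -- At most `2R + 1` coordinates around `a`, and `R` at each end of the range for paths across the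
  -- seam.
  have hsub : (Finset.univ.filter fun b => coordDist p a b ≤ R).image (fun b : Fin M => (b : ℕ)) ⊆
      (Finset.Icc (a - R : ℕ) (a + R) ∪ Finset.range R) ∪ Finset.Ico (M - R) M := by
    intro x hx
    obtain ⟨b, hb, rfl⟩ := Finset.mem_image.1 hx
    have h := near_or_far_of_coordDist_le (Finset.mem_filter.1 hb).2
    have := a.2
    have := b.2
    simp only [Finset.mem_union, Finset.mem_Icc, Finset.mem_range, Finset.mem_Ico]
    omega
  rw [← Finset.card_image_of_injective _ Fin.val_injective]
  refine (Finset.card_le_card hsub).trans ((Finset.card_union_le _ _).trans ?_)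
  have := Finset.card_union_le (Finset.Icc (a - R : ℕ) (a + R)) (Finset.range R)
  simp only [Nat.card_Icc, Finset.card_range, Nat.card_Ico] at *
  omega

open scoped Classical in
theorem card_ball_le (bc : Fin D → Bool) (R : ℕ) (i : Site D M) :
    (Finset.univ.filter fun j => siteDist bc i j ≤ R).card ≤ (4 * R + 1) ^ D := by
  have hsub : (Finset.univ.filter fun j => siteDist bc i j ≤ R) ⊆
      Fintype.piFinset fun δ => Finset.univ.filter fun b => coordDist (bc δ) (i δ) b ≤ R := by
    intro j hj
    refine Fintype.mem_piFinset.2 fun δ => Finset.mem_filter.2 ⟨Finset.mem_univ _, ?_⟩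
    exact (coordDist_le_siteDist bc i j δ).trans (Finset.mem_filter.1 hj).2
  refine (Finset.card_le_card hsub).trans ?_
  rw [Fintype.card_piFinset]
  exact (Finset.prod_le_pow_card _ _ _ fun δ _ => card_coordDist_le _ _ _).trans (by simp)

theorem ncard_not_disjoint_ball_le (bc : Fin D → Bool) (R : ℕ) (i : Site D M) :
    {j | ¬ Disjoint (ball bc R i) (ball bc R j)}.ncard ≤ (4 * R + 1) ^ (2 * D) := by
  classical
  have hsub : {j | ¬ Disjoint (ball bc R i) (ball bc R j)} ⊆
      (((Finset.univ.filter fun p => siteDist bc i p ≤ R).biUnion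
        fun p => Finset.univ.filter fun j => siteDist bc p j ≤ R : Finset (Site D M)) :
          Set (Site D M)) := by
    intro j hj
    obtain ⟨p, hp, hp'⟩ := Set.not_disjoint_iff.1 hj
    simp only [Finset.coe_biUnion, Set.mem_iUnion, Finset.mem_coe, Finset.mem_filter,
      Finset.mem_univ, true_and]
    exact ⟨p, hp, by rw [siteDist_comm]; exact hp'⟩
  refine (Set.ncard_le_ncard hsub (Finset.finite_toSet _)).trans ?_
  rw [Set.ncard_coe_finset]
  refine (Finset.card_biUnion_le_card_mul _ _ _ fun p _ => card_ball_le bc R p).trans ?_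
  rw [two_mul, pow_add]
  exact Nat.mul_le_mul_right _ (card_ball_le bc R i)

theorem card_layers_le (δ₀ : Fin D) (L : Finset ℕ) {s : Finset (Site D M)}
    (hs : ∀ i ∈ s, (i δ₀ : ℕ) ∈ L) : s.card ≤ L.card * M ^ (D - 1) := by
  classical
  have hsub : s ⊆ Fintype.piFinset fun δ =>
      if δ = δ₀ then Finset.univ.filter fun b : Fin M => (b : ℕ) ∈ L else Finset.univ := by
    intro i hi
    refine Fintype.mem_piFinset.2 fun δ => ?_
    split_ifs with h
    · subst h; exact Finset.mem_filter.2 ⟨Finset.mem_univ _, hs i hi⟩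
    · exact Finset.mem_univ _
  have hL : (Finset.univ.filter fun b : Fin M => (b : ℕ) ∈ L).card ≤ L.card := by
    rw [← Finset.card_image_of_injective _ Fin.val_injective]
    refine Finset.card_le_card fun x hx => ?_
    obtain ⟨b, hb, rfl⟩ := Finset.mem_image.1 hx
    exact (Finset.mem_filter.1 hb).2
  refine (Finset.card_le_card hsub).trans ?_
  rw [Fintype.card_piFinset, ← Finset.mul_prod_erase _ _ (Finset.mem_univ δ₀), if_pos rfl]
  refine Nat.mul_le_mul hL (le_of_eq ?_)
  rw [Finset.prod_congr rfl (g := fun _ => M)]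
  · simp
  · intro δ hδ
    rw [if_neg (Finset.ne_of_mem_erase hδ)]
    simp

/-- The `b`-th slab of width `w` in direction `δ₀`. -/
def slab (M : ℕ) (δ₀ : Fin D) (w b : ℕ) : Finset (Site D M) :=
  Finset.univ.filter fun i => b * w ≤ i δ₀ ∧ (i δ₀ : ℕ) < b * w + w

/-- The sites of the `b`-th slab at depth at least `2 * R`. -/
def slabInner (M : ℕ) (δ₀ : Fin D) (R w b : ℕ) : Finset (Site D M) :=
  Finset.univ.filter fun i => b * w + 2 * R ≤ i δ₀ ∧ (i δ₀ : ℕ) + 2 * R < b * w + w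

/-- The sites of the `b`-th slab at depth at least `R`. -/
def slabCore (M : ℕ) (δ₀ : Fin D) (R w b : ℕ) : Set (Site D M) :=
  {i | b * w + R ≤ i δ₀ ∧ (i δ₀ : ℕ) + R < b * w + w}

variable {δ₀ : Fin D} {R w b c : ℕ}

theorem mem_slab {i : Site D M} :
    i ∈ slab M δ₀ w b ↔ b * w ≤ i δ₀ ∧ (i δ₀ : ℕ) < b * w + w := by
  simp [slab]

theorem mem_slabInner {i : Site D M} :
    i ∈ slabInner M δ₀ R w b ↔ b * w + 2 * R ≤ i δ₀ ∧ (i δ₀ : ℕ) + 2 * R < b * w + w := by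
  simp [slabInner]

theorem slabInner_subset_slab : slabInner M δ₀ R w b ⊆ slab M δ₀ w b := fun i hi => by
  rw [mem_slab]; rw [mem_slabInner] at hi; omega

/-- A ball of radius `R` costs depth `R`, from `2R` to `R`. It cannot cross the seam, because the
inner layers are at least `2R` away from both ends of the coordinate range. -/
theorem ball_subset_slabCore (bc : Fin D → Bool) (hb : b * w + w ≤ M) {i : Site D M}
    (hi : i ∈ slabInner M δ₀ R w b) : ball bc R i ⊆ slabCore M δ₀ R w b := by
  intro j hj
  rw [mem_slabInner] at hi
  have h := near_or_far_of_coordDist_le ((coordDist_le_siteDist bc i j δ₀).trans hj)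
  have := (i δ₀).2
  have := (j δ₀).2
  simp only [slabCore, Set.mem_ofPred_eq]
  omega

/-- The depth `R` of the core also shields it from terms centred outside the slab, including those
reaching across the seam. -/
theorem ball_subset_compl_slabCore (bc : Fin D → Bool) (hb : b * w + w ≤ M) {i : Site D M}
    (hi : i ∉ slab M δ₀ w b) : ball bc R i ⊆ (slabCore M δ₀ R w b)ᶜ := by
  intro j hj hj'
  rw [mem_slab] at hi
  have h := near_or_far_of_coordDist_le ((coordDist_le_siteDist bc i j δ₀).trans hj)
  have := (i δ₀).2
  have := (j δ₀).2
  simp only [slabCore, Set.mem_ofPred_eq] at hj'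
  omega

theorem disjoint_slab (hbc : b ≠ c) : Disjoint (slab M δ₀ w b) (slab M δ₀ w c) := by
  rw [Finset.disjoint_left]
  intro i hi hi'
  rw [mem_slab] at hi hi'
  rcases Nat.lt_or_gt_of_ne hbc with h | h
  · have := Nat.mul_le_mul_right w (Nat.succ_le_of_lt h)
    rw [Nat.succ_mul] at this
    omega
  · have := Nat.mul_le_mul_right w (Nat.succ_le_of_lt h)
    rw [Nat.succ_mul] at this
    omega

theorem card_slabInner_le : (slabInner M δ₀ R w b).card ≤ w * M ^ (D - 1) := by
  refine (card_layers_le δ₀ (Finset.Ico (b * w) (b * w + w)) fun i hi => ?_).trans (by simp)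
  rw [mem_slabInner] at hi
  rw [Finset.mem_Ico]
  omega

theorem card_slab_sdiff_slabInner_le :
    (slab M δ₀ w b \ slabInner M δ₀ R w b).card ≤ 4 * R * M ^ (D - 1) := by
  refine (card_layers_le δ₀ (Finset.Ico (b * w) (b * w + 2 * R) ∪
    Finset.Ico (b * w + w - 2 * R) (b * w + w)) fun i hi => ?_).trans
      (Nat.mul_le_mul_right _ ((Finset.card_union_le _ _).trans ?_))
  · rw [Finset.mem_sdiff, mem_slab, mem_slabInner] at hi
    simp only [Finset.mem_union, Finset.mem_Ico]
    omega
  · simp only [Nat.card_Ico]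
    omega

theorem card_biUnion_slab_sdiff_le (s : Finset (Fin (M / w))) :
    (s.biUnion fun b => slab M δ₀ w b \ slabInner M δ₀ R w b).card ≤
      s.card * (4 * R * M ^ (D - 1)) :=
  Finset.card_biUnion_le_card_mul _ _ _ fun _ _ => card_slab_sdiff_slabInner_le

/-- Besides the layers near the slab faces there are fewer than `w` layers left over, as `w` need
not divide `M`. -/
theorem card_compl_biUnion_slabInner_le (hw : 0 < w) :
    (Finset.univ \ Finset.univ.biUnion fun b : Fin (M / w) => slabInner M δ₀ R w b).card ≤
      (M / w * (4 * R) + w) * M ^ (D - 1) := by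
  have hsub : (Finset.univ \ Finset.univ.biUnion fun b : Fin (M / w) => slabInner M δ₀ R w b) ⊆
      (Finset.univ.biUnion fun b : Fin (M / w) => slab M δ₀ w b \ slabInner M δ₀ R w b) ∪
        Finset.univ.filter fun i : Site D M => M / w * w ≤ i δ₀ := by
    intro i hi
    simp only [Finset.mem_sdiff, Finset.mem_univ, true_and, Finset.mem_biUnion, not_exists] at hi
    rw [Finset.mem_union]
    by_cases h : M / w * w ≤ i δ₀
    · exact Or.inr (Finset.mem_filter.2 ⟨Finset.mem_univ _, h⟩)
    · left
      have hlt : (i δ₀ : ℕ) / w < M / w := (Nat.div_lt_iff_lt_mul hw).2 (by omega)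
      refine Finset.mem_biUnion.2 ⟨⟨_, hlt⟩, Finset.mem_univ _, Finset.mem_sdiff.2 ⟨?_, hi _⟩⟩
      rw [mem_slab]
      exact ⟨Nat.div_mul_le_self _ _, Nat.lt_div_mul_add hw⟩
  have hrest : (Finset.univ.filter fun i : Site D M => M / w * w ≤ i δ₀).card ≤
      w * M ^ (D - 1) := by
    refine (card_layers_le δ₀ (Finset.Ico (M / w * w) M) fun i hi => ?_).trans
      (Nat.mul_le_mul_right _ ?_)
    · exact Finset.mem_Ico.2 ⟨(Finset.mem_filter.1 hi).2, (i δ₀).2⟩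
    · rw [Nat.card_Ico]
      have := Nat.div_add_mod' M w
      have := Nat.mod_lt M hw
      omega
  refine (Finset.card_le_card hsub).trans ((Finset.card_union_le _ _).trans ?_)
  have := card_biUnion_slab_sdiff_le (δ₀ := δ₀) (R := R) (Finset.univ : Finset (Fin (M / w)))
  rw [Finset.card_univ, Fintype.card_fin] at this
  rw [add_mul]
  refine add_le_add (this.trans (le_of_eq ?_)) hrest
  ring

end Geometry

/-! ### Decoupling the slabs. -/

section Decoupling

variable {D M : ℕ} {d : Site D M → ℕ} {bc : Fin D → Bool} {R Δ : ℕ} {g : ℝ}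
  {a : Site D M → Operator d} {w : ℕ} {δ₀ : Fin D}

theorem mul_add_le_of_fin_div (b : Fin (M / w)) : (b : ℕ) * w + w ≤ M := by
  have := Nat.mul_le_mul_right w (Nat.succ_le_of_lt b.2)
  rw [Nat.succ_mul] at this
  exact this.trans (Nat.div_mul_le_self _ _)

theorem isHermitian_sum {n ι : Type*} {s : Finset ι} {A : ι → Matrix n n ℂ}
    (h : ∀ i, (A i).IsHermitian) : (∑ i ∈ s, A i).IsHermitian := by
  rw [Matrix.IsHermitian, Matrix.conjTranspose_sum]
  exact Finset.sum_congr rfl fun i _ => (h i).eq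

/-- The part of a sum of local terms which is well inside the `b`-th slab. -/
def blockTerm (δ₀ : Fin D) (R w : ℕ) (a : Site D M → Operator d) (b : Fin (M / w)) : Operator d :=
  ∑ i ∈ slabInner M δ₀ R w b, a i

theorem blockTerm_actsOn (ha : IsBoundedFamily (ball bc R) g Δ a) (b : Fin (M / w)) :
    ActsOn (slabCore M δ₀ R w b) (blockTerm δ₀ R w a b) :=
  actsOn_sum fun i hi => (ha.actsOn i).mono (ball_subset_slabCore bc (mul_add_le_of_fin_div b) hi)

theorem blockTerm_actsOn_compl (ha : IsBoundedFamily (ball bc R) g Δ a) {b c : Fin (M / w)}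
    (hbc : b ≠ c) : ActsOn (slabCore M δ₀ R w b)ᶜ (blockTerm δ₀ R w a c) :=
  actsOn_sum fun i hi => (ha.actsOn i).mono
    (ball_subset_compl_slabCore bc (mul_add_le_of_fin_div b) fun hi' =>
      Finset.disjoint_left.1 (disjoint_slab (fun h => hbc (Fin.ext h))) hi'
        (slabInner_subset_slab hi))

theorem blockTerm_isHermitian (ha : IsBoundedFamily (ball bc R) g Δ a) (b : Fin (M / w)) :
    (blockTerm δ₀ R w a b).IsHermitian := isHermitian_sum ha.isHermitian

theorem ntr_blockTerm (ha : IsBoundedFamily (ball bc R) g Δ a) (b : Fin (M / w)) :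
    ntr (blockTerm δ₀ R w a b) = 0 := by
  rw [blockTerm, ntr_sum]
  exact Finset.sum_eq_zero fun i _ => ha.ntr_eq_zero i

theorem sum_blockTerm (s : Finset (Fin (M / w))) :
    ∑ b ∈ s, blockTerm δ₀ R w a b = ∑ i ∈ s.biUnion fun b => slabInner M δ₀ R w b, a i := by
  rw [Finset.sum_biUnion]
  · rfl
  · intro b _ c _ hbc
    exact (disjoint_slab (fun h => hbc (Fin.ext h))).mono slabInner_subset_slab
      slabInner_subset_slab

variable [Nonempty (Config d)]

theorem mom4_blockTerm_le (ha : IsBoundedFamily (ball bc R) g Δ a) (b : Fin (M / w)) :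
    mom4 (blockTerm δ₀ R w a b) ≤ 7 * g ^ 4 * (Δ * (w * M ^ (D - 1) : ℝ)) ^ 2 := by
  refine (mom4_sum_le ha _).trans ?_
  have : ((slabInner M δ₀ R w b).card : ℝ) ≤ w * M ^ (D - 1) := by
    exact_mod_cast card_slabInner_le
  have h4 : 0 ≤ g ^ 4 := Even.pow_nonneg (by decide) g
  gcongr

/-- Almost all of the variance of a sum of local terms comes from the blocks. -/
theorem mom2_sum_le_sum_mom2_blockTerm (ha : IsBoundedFamily (ball bc R) g Δ a) (hw : 0 < w) :
    mom2 (∑ i, a i) ≤ 2 * ∑ b, mom2 (blockTerm δ₀ R w a b) +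
      2 * (Δ * g ^ 2 * ((((M / w : ℕ) : ℝ) * (4 * R) + w) * M ^ (D - 1))) := by
  classical
  have hsplit : ∑ i, a i = ∑ b, blockTerm δ₀ R w a b + ∑ i ∈ Finset.univ \
      Finset.univ.biUnion fun b : Fin (M / w) => slabInner M δ₀ R w b, a i := by
    rw [sum_blockTerm, add_comm, Finset.sum_sdiff (Finset.subset_univ _)]
  rw [hsplit]
  refine (mom2_add_le (isHermitian_sum (blockTerm_isHermitian ha))
    (isHermitian_sum ha.isHermitian)).trans (add_le_add ?_ ?_)
  · rw [mom2_sum_of_disjoint _ _ _ (blockTerm_actsOn ha) (fun b c => blockTerm_actsOn_compl ha)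
      (ntr_blockTerm ha)]
  · refine mul_le_mul_of_nonneg_left ((mom2_sum_le ha _).trans ?_) zero_le_two
    refine mul_le_mul_of_nonneg_left ?_ (by positivity)
    exact_mod_cast card_compl_biUnion_slabInner_le hw

/-- The characteristic function of a sum of local terms is bounded by a product over any set of
blocks, up to an error controlled by the terms at the boundaries of these blocks. -/
theorem norm_ntr_evol_sum_le (ha : IsBoundedFamily (ball bc R) g Δ a)
    (s : Finset (Fin (M / w))) {t : ℝ} (ht : 0 ≤ t) :
    ‖ntr (evol (∑ i, a i) t)‖ ≤ ∏ b ∈ s, ‖ntr (evol (blockTerm δ₀ R w a b) t)‖ +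
      t * √(Δ * g ^ 2 * (s.card * (4 * R * M ^ (D - 1)))) := by
  classical
  -- Only `V`, the face terms of the chosen slabs, is deleted. The rest of the lattice stays coupled
  -- inside `B`, so the cost scales with `s.card` and not with the number of all slabs.
  set V := ∑ i ∈ s.biUnion fun b => slab M δ₀ w b \ slabInner M δ₀ R w b, a i with hV
  set B := ∑ i ∈ Finset.univ \ s.biUnion fun b => slab M δ₀ w b, a i with hB
  have hsets : (s.biUnion fun b => slab M δ₀ w b) =
      (s.biUnion fun b => slabInner M δ₀ R w b) ∪
        s.biUnion fun b => slab M δ₀ w b \ slabInner M δ₀ R w b := by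
    ext i
    simp only [Finset.mem_union, Finset.mem_biUnion, Finset.mem_sdiff]
    constructor
    · rintro ⟨b, hb, hi⟩
      by_cases h : i ∈ slabInner M δ₀ R w b
      · exact Or.inl ⟨b, hb, h⟩
      · exact Or.inr ⟨b, hb, hi, h⟩
    · rintro (⟨b, hb, hi⟩ | ⟨b, hb, hi, -⟩)
      · exact ⟨b, hb, slabInner_subset_slab hi⟩
      · exact ⟨b, hb, hi⟩
  have hdisj : Disjoint (s.biUnion fun b => slabInner M δ₀ R w b)
      (s.biUnion fun b => slab M δ₀ w b \ slabInner M δ₀ R w b) := by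
    rw [Finset.disjoint_left]
    intro i hi hi'
    obtain ⟨b, -, hb⟩ := Finset.mem_biUnion.1 hi
    obtain ⟨c, -, hc⟩ := Finset.mem_biUnion.1 hi'
    rw [Finset.mem_sdiff] at hc
    by_cases hbc : b = c
    · subst hbc; exact hc.2 hb
    · exact Finset.disjoint_left.1 (disjoint_slab (fun h => hbc (Fin.ext h)))
        (slabInner_subset_slab hb) hc.1
  have hsplit : ∑ i, a i = (∑ b ∈ s, blockTerm δ₀ R w a b + B) + V := by
    rw [sum_blockTerm, hB, hV, add_right_comm, ← Finset.sum_union hdisj, ← hsets, add_comm,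
      Finset.sum_sdiff (Finset.subset_univ _)]
  have hBh : B.IsHermitian := isHermitian_sum ha.isHermitian
  have hH : (∑ i, a i).IsHermitian := isHermitian_sum ha.isHermitian
  have hH' : (∑ b ∈ s, blockTerm δ₀ R w a b + B).IsHermitian :=
    (isHermitian_sum (blockTerm_isHermitian ha)).add hBh
  have h1 := norm_ntr_evol_sub_le hH hH' ht
  rw [hsplit, add_sub_cancel_left] at h1
  have h2 := norm_ntr_evol_sum_add_le s _ _ B (blockTerm_actsOn (δ₀ := δ₀) (w := w) ha)
    (fun b c => blockTerm_actsOn_compl ha)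
    (fun b hb => actsOn_sum fun i hi => (ha.actsOn i).mono
      (ball_subset_compl_slabCore bc (mul_add_le_of_fin_div b) fun hi' =>
        (Finset.mem_sdiff.1 hi).2 (Finset.mem_biUnion.2 ⟨b, hb, hi'⟩))) hBh t
  have h3 : √(mom2 V) ≤ √(Δ * g ^ 2 * (s.card * (4 * R * M ^ (D - 1)))) := by
    refine Real.sqrt_le_sqrt ((mom2_sum_le ha _).trans ?_)
    refine mul_le_mul_of_nonneg_left ?_ (by positivity)
    exact_mod_cast card_biUnion_slab_sdiff_le s
  rw [hsplit]
  calc _ ≤ _ := norm_le_norm_add_norm_sub _ _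
    _ ≤ _ := add_le_add h2 ((norm_sub_rev _ _).le.trans (h1.trans
        (mul_le_mul_of_nonneg_left h3 ht)))

end Decoupling

/-- Among the subsets of given cardinality there is one whose sum is at least the average. -/
theorem exists_subset_card_mul_sum_le {ι : Type*} (f : ι → ℝ) (u : Finset ι) {k : ℕ}
    (hk : k ≤ u.card) :
    ∃ s ⊆ u, s.card = k ∧ (k : ℝ) * ∑ i ∈ u, f i ≤ u.card * ∑ i ∈ s, f i := by
  classical
  induction u using Finset.strongInduction with
  | H u ih =>
    rcases hk.eq_or_lt with rfl | hlt
    · exact ⟨u, subset_rfl, rfl, le_rfl⟩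
    -- Discarding a smallest value does not lower the average.
    obtain ⟨b, hb, hmin⟩ := Finset.exists_min_image u f
      (Finset.card_pos.1 (Nat.zero_lt_of_lt hlt))
    have hcard := Finset.card_erase_of_mem hb
    obtain ⟨s, hs, hsk, hle⟩ := ih (u.erase b) (Finset.erase_ssubset hb) (by omega)
    refine ⟨s, hs.trans (Finset.erase_subset _ _), hsk, ?_⟩
    rcases Nat.eq_zero_or_pos k with rfl | hkpos
    · rw [Finset.card_eq_zero.1 hsk]; simp
    have hn : ((u.erase b).card : ℝ) = u.card - 1 := by
      rw [hcard, Nat.cast_sub (by omega), Nat.cast_one]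
    have hn0 : (0 : ℝ) < u.card - 1 := by
      rw [← hn]; exact_mod_cast (by omega : 0 < (u.erase b).card)
    have hb' : ((u.card : ℝ) - 1) * f b ≤ ∑ i ∈ u.erase b, f i := by
      rw [← hn, ← nsmul_eq_mul]
      exact Finset.card_nsmul_le_sum _ _ _ fun i hi => hmin i (Finset.mem_of_mem_erase hi)
    rw [hn] at hle
    rw [← Finset.add_sum_erase u f hb]
    refine le_of_mul_le_mul_left ?_ hn0
    have hk0 : (0 : ℝ) ≤ k := Nat.cast_nonneg _
    have h1 := mul_le_mul_of_nonneg_left hb' hk0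
    have hu0 : (0 : ℝ) ≤ u.card := Nat.cast_nonneg _
    have h2 := mul_le_mul_of_nonneg_left hle hu0
    linarith

/-! ### Gaussian bound from `k` blocks. -/

section BlockBound

variable {D M : ℕ} {d : Site D M → ℕ} {bc : Fin D → Bool} {R Δ : ℕ} {g : ℝ}
  {a : Site D M → Operator d} [Nonempty (Config d)] {w : ℕ} (δ₀ : Fin D)

/-- Single blocks may have small variance, so `k` blocks of at least average total variance are
selected; the fourth moment bound is the same for all blocks. -/
theorem norm_ntr_evol_sum_le_exp (ha : IsBoundedFamily (ball bc R) g Δ a) {k : ℕ}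
    (hk : k ≤ M / w) (hK : 0 < M / w) {t : ℝ} (ht : 0 ≤ t) :
    ‖ntr (evol (∑ i, a i) t)‖ ≤
      Real.exp (k * (-(5 / 12) * (t ^ 2 * ((∑ b, mom2 (blockTerm δ₀ R w a b)) / (M / w : ℕ))) +
        5 / 24 * (t ^ 4 * (7 * g ^ 4 * (Δ * (w * M ^ (D - 1) : ℝ)) ^ 2)))) +
      t * √(Δ * g ^ 2 * (k * (4 * R * M ^ (D - 1)))) := by
  obtain ⟨s, -, hs, hsum⟩ := exists_subset_card_mul_sum_le
    (fun b : Fin (M / w) => mom2 (blockTerm δ₀ R w a b)) Finset.univ (k := k) (by simpa using hk)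
  have h := norm_ntr_evol_sum_le (δ₀ := δ₀) (w := w) ha s ht
  rw [hs] at h
  refine h.trans (add_le_add_left ?_ _)
  have hK' : (0 : ℝ) < (M / w : ℕ) := by exact_mod_cast hK
  rw [Finset.card_univ, Fintype.card_fin] at hsum
  calc ∏ b ∈ s, ‖ntr (evol (blockTerm δ₀ R w a b) t)‖
      ≤ ∏ b ∈ s, Real.exp (-(5 / 12) * (t ^ 2 * mom2 (blockTerm δ₀ R w a b)) +
          5 / 24 * (t ^ 4 * (7 * g ^ 4 * (Δ * (w * M ^ (D - 1) : ℝ)) ^ 2))) := by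
        refine Finset.prod_le_prod (fun _ _ => norm_nonneg _) fun b _ => ?_
        refine (norm_ntr_evol_le_exp (blockTerm_isHermitian ha b) (ntr_blockTerm ha b) t).trans ?_
        have := mom4_blockTerm_le (δ₀ := δ₀) (w := w) ha b
        have h4 : 0 ≤ t ^ 4 := by positivity
        gcongr
    _ ≤ _ := by
        rw [← Real.exp_sum]
        refine Real.exp_le_exp.2 ?_
        rw [Finset.sum_add_distrib, ← Finset.mul_sum, ← Finset.mul_sum, Finset.sum_const, hs,
          nsmul_eq_mul, mul_add, mul_left_comm (k : ℝ) (-(5 / 12))]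
        refine add_le_add_left ?_ _
        have : (k : ℝ) * ((∑ b, mom2 (blockTerm δ₀ R w a b)) / (M / w : ℕ)) ≤
            ∑ b ∈ s, mom2 (blockTerm δ₀ R w a b) := by
          rw [← mul_div_assoc, div_le_iff₀ hK', mul_comm (∑ b ∈ s, _)]
          exact hsum
        have := mul_le_mul_of_nonneg_left this (sq_nonneg t)
        linarith

end BlockBound

/-! ### Time average and optimization over the number of blocks. -/

section Average

theorem average_le_of_le_gaussian_add {f : ℝ → ℝ} (hf : Continuous f) {T α β : ℝ} (hT : 0 < T)
    (hα : 0 < α) (h : ∀ t ∈ Set.Ioc 0 T, f t ≤ Real.exp (-α * (t / T) ^ 2) + β) :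
    1 / T * ∫ t in (0 : ℝ)..T, f t ≤ √(Real.pi / α) / 2 + β := by
  have hb : 0 < α / T ^ 2 := by positivity
  have hexp : ∀ t, Real.exp (-α * (t / T) ^ 2) = Real.exp (-(α / T ^ 2) * t ^ 2) := fun t => by
    congr 1; field_simp
  have hgauss : ∫ t in (0 : ℝ)..T, Real.exp (-(α / T ^ 2) * t ^ 2) ≤
      √(Real.pi / (α / T ^ 2)) / 2 := by
    rw [intervalIntegral.integral_of_le hT.le, ← integral_gaussian_Ioi]
    exact MeasureTheory.setIntegral_mono_set (integrable_exp_neg_mul_sq hb).integrableOn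
      (Filter.Eventually.of_forall fun t => (Real.exp_pos _).le)
      Set.Ioc_subset_Ioi_self.eventuallyLE
  have hcont : Continuous fun t : ℝ => Real.exp (-(α / T ^ 2) * t ^ 2) := by fun_prop
  have hint : ∫ t in (0 : ℝ)..T, f t ≤
      ∫ t in (0 : ℝ)..T, (Real.exp (-(α / T ^ 2) * t ^ 2) + β) := by
    refine intervalIntegral.integral_mono_on_of_le_Ioo hT.le (hf.intervalIntegrable _ _)
      ((hcont.add continuous_const).intervalIntegrable _ _) fun t ht => ?_
    rw [← hexp]
    exact h t ⟨ht.1, ht.2.le⟩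
  rw [intervalIntegral.integral_add (hcont.intervalIntegrable _ _)
    (continuous_const.intervalIntegrable _ _), intervalIntegral.integral_const, sub_zero,
    smul_eq_mul] at hint
  have hsqrt : √(Real.pi / (α / T ^ 2)) = T * √(Real.pi / α) := by
    rw [show Real.pi / (α / T ^ 2) = T ^ 2 * (Real.pi / α) by field_simp,
      Real.sqrt_mul (sq_nonneg T), Real.sqrt_sq hT.le]
  rw [hsqrt] at hgauss
  calc 1 / T * ∫ t in (0 : ℝ)..T, f t ≤ 1 / T * (T * √(Real.pi / α) / 2 + T * β) := by
        gcongr; linarith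
    _ = _ := by field_simp

/-- A bound by Gaussians with a free number `k` of factors, each costing an error of order
`√k`, turns into a Gaussian bound with small error after optimizing `k`. -/
theorem le_gaussian_add_of_forall_le {y s m q A E : ℝ} {K : ℕ} (hs : 0 < s) (hs1 : s ≤ 1)
    (hm : 1 ≤ m) (hq : 0 < q) (hA : 0 < A) (hE : 0 ≤ E) (hK : m ^ 2 / 4 ≤ K)
    (h : ∀ k ≤ K, y ≤ Real.exp (-(k * (s ^ 2 * (A * q ^ 6)))) +
      √(E * (s ^ 2 * q ^ 4 / m ^ 3) * k)) :
    y ≤ Real.exp (-(A * q ^ 6 * m ^ 2 / 4) * s ^ 2) +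
      (1 / (A * q ^ 2) + √(E * (1 + q ^ 4))) / m := by
  have hm0 : 0 < m := by linarith
  -- At `k = κ` the square root equals `√E / m`, and the exponent is `A q² m`, so `exp (-x) ≤ 1 / x`
  -- gives order `1 / m` as well. Rounding up to an integer accounts for the summand `q⁴`.
  set κ := m / q ^ 4 / s ^ 2 with hκ
  have hκ0 : 0 < κ := by positivity
  have hsqrt : ∀ k : ℕ, (k : ℝ) ≤ κ + 1 →
      √(E * (s ^ 2 * q ^ 4 / m ^ 3) * k) ≤ √(E * (1 + q ^ 4)) / m := by
    intro k hk
    rw [Real.sqrt_le_left (by positivity), div_pow, Real.sq_sqrt (by positivity)]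
    calc E * (s ^ 2 * q ^ 4 / m ^ 3) * k ≤ E * (s ^ 2 * q ^ 4 / m ^ 3) * (κ + 1) := by gcongr
      _ = E * (1 + s ^ 2 * q ^ 4 / m) / m ^ 2 := by rw [hκ]; field_simp
      _ ≤ E * (1 + q ^ 4) / m ^ 2 := by
          gcongr
          calc s ^ 2 * q ^ 4 / m ≤ 1 * q ^ 4 / 1 := by
                gcongr
                exact pow_le_one₀ hs.le hs1
            _ = q ^ 4 := by ring
  have hc : (⌈κ⌉₊ : ℝ) ≤ κ + 1 := (Nat.ceil_lt_add_one hκ0.le).le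
  have hpos1 : 0 ≤ 1 / (A * q ^ 2) / m := by positivity
  rw [add_div]
  -- For small `s` there are fewer than `κ` blocks available; using all `K ≥ m² / 4` of them
  -- produces the Gaussian.
  rcases le_total K ⌈κ⌉₊ with hle | hle
  · have h1 := h K le_rfl
    have h2 := hsqrt K ((Nat.cast_le.2 hle).trans hc)
    have h3 : Real.exp (-(K * (s ^ 2 * (A * q ^ 6)))) ≤
        Real.exp (-(A * q ^ 6 * m ^ 2 / 4) * s ^ 2) := by
      refine Real.exp_le_exp.2 ?_
      have : m ^ 2 / 4 * (s ^ 2 * (A * q ^ 6)) ≤ K * (s ^ 2 * (A * q ^ 6)) := by gcongr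
      linarith
    linarith
  · have h1 := h _ hle
    have h2 := hsqrt _ hc
    have h3 : Real.exp (-(⌈κ⌉₊ * (s ^ 2 * (A * q ^ 6)))) ≤ 1 / (A * q ^ 2) / m := by
      have hx : 0 < A * q ^ 2 * m := by positivity
      have h4 : A * q ^ 2 * m ≤ ⌈κ⌉₊ * (s ^ 2 * (A * q ^ 6)) := by
        calc A * q ^ 2 * m = κ * (s ^ 2 * (A * q ^ 6)) := by rw [hκ]; field_simp
          _ ≤ _ := by gcongr; exact Nat.le_ceil κ
      rw [div_div, Real.exp_neg, one_div]
      refine inv_anti₀ hx ?_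
      exact h4.trans ((le_add_of_nonneg_right zero_le_one).trans (Real.add_one_le_exp _))
    have := Real.exp_pos (-(A * q ^ 6 * m ^ 2 / 4) * s ^ 2)
    linarith

end Average

/-! ### Reduction to centered self-adjoint local terms. -/

section Reduction

variable {D M : ℕ} {d : Site D M → ℕ}

theorem star_ntr_of_isHermitian {n : Type*} [Fintype n] {A : Matrix n n ℂ} (hA : A.IsHermitian) :
    star (ntr A) = ntr A := by
  have h1 := Matrix.trace_conjTranspose A
  rw [hA.eq] at h1
  rw [ntr, star_div₀, ← h1, star_natCast]

theorem norm_phi_eq {H : Operator d} (hH : H.IsHermitian) (t : ℝ) :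
    ‖phi H t‖ = ‖ntr (evol (H - ntr H • (1 : Operator d)) t)‖ := by
  obtain ⟨c, hc⟩ := Complex.conj_eq_iff_real.1 (star_ntr_of_isHermitian hH)
  rw [hc]
  set X := H - (c : ℂ) • (1 : Operator d) with hX
  have hsplit : (Complex.I * (t : ℂ)) • H =
      (Complex.I * (t : ℂ)) • X + (Complex.I * ((t * c : ℝ) : ℂ)) • (1 : Operator d) := by
    rw [hX, smul_sub, smul_smul]
    push_cast
    rw [mul_assoc, sub_add_cancel]
  have hphase : NormedSpace.exp ((Complex.I * ((t * c : ℝ) : ℂ)) • (1 : Operator d)) =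
      Complex.exp (Complex.I * ((t * c : ℝ) : ℂ)) • (1 : Operator d) := by
    rw [← Matrix.diagonal_one, ← Matrix.diagonal_smul, Matrix.exp_diagonal, ← Matrix.diagonal_smul]
    congr 1
    funext i
    rw [Pi.coe_exp, Complex.exp_eq_exp_ℂ]
    simp
  have hcomm : Commute ((Complex.I * (t : ℂ)) • X)
      ((Complex.I * ((t * c : ℝ) : ℂ)) • (1 : Operator d)) := (Commute.one_right _).smul_right _
  have : phi H t = Complex.exp (Complex.I * ((t * c : ℝ) : ℂ)) * ntr (evol X t) := by
    rw [phi, hsplit, Matrix.exp_add_of_commute _ _ hcomm, hphase, mul_smul_comm, mul_one,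
      ← ntr_smul]
    rfl
  rw [this, norm_mul, mul_comm Complex.I, Complex.norm_exp_ofReal_mul_I, one_mul]

/-- The given terms need not be self-adjoint, only their sum is; replacing each by its self-adjoint
part keeps support, norm bound and sum. Centering at most doubles the norm, and the `+ 1` keeps the
bound positive. -/
theorem exists_isBoundedFamily [Nonempty (Config d)] {bc : Fin D → Bool} {R : ℕ} {h : ℝ}
    {H : Operator d} (hH : IsLocalHamiltonian bc R h d H) :
    ∃ a : Site D M → Operator d,
      IsBoundedFamily (ball bc R) (2 * (|h| + 1)) ((4 * R + 1) ^ (2 * D)) a ∧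
        ∑ i, a i = H - ntr H • (1 : Operator d) := by
  obtain ⟨f, hsum, hf⟩ := hH.exists_terms
  set b : Site D M → Operator d := fun i => (1 / 2 : ℂ) • (f i + (f i).conjTranspose) with hb
  have hbherm : ∀ i, (b i).IsHermitian := fun i => by
    simp only [hb, Matrix.IsHermitian, Matrix.conjTranspose_smul, Matrix.conjTranspose_add,
      Matrix.conjTranspose_conjTranspose]
    rw [add_comm]
    congr 1
    simp
  have hbnorm : ∀ i, ‖b i‖ ≤ |h| := fun i => by
    have h1 := norm_smul_le (1 / 2 : ℂ) (f i + (f i).conjTranspose)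
    have h2 := norm_add_le (f i) (f i).conjTranspose
    rw [Matrix.l2_opNorm_conjTranspose] at h2
    have h3 := (hf i).2.trans (le_abs_self h)
    have h4 : ‖(1 / 2 : ℂ)‖ = 1 / 2 := by simp
    rw [h4] at h1
    linarith
  have hbsum : ∑ i, b i = H := by
    have hherm := hH.isHermitian.eq
    simp only [hb]
    rw [← Finset.smul_sum, Finset.sum_add_distrib, ← Matrix.conjTranspose_sum, ← hsum, hherm,
      ← two_smul ℂ, smul_smul]
    norm_num
  have hbacts : ∀ i, ActsOn (ball bc R i) (b i) := fun i =>
    ((hf i).1.add (hf i).1.conjTranspose).smul _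
  clear_value b
  have hntr := fun i => star_ntr_of_isHermitian (hbherm i)
  have hone : ‖(1 : Operator d)‖ ≤ 1 := by
    have := norm_evol_le (A := (0 : Operator d)) Matrix.isHermitian_zero 0
    simpa only [evol, smul_zero, NormedSpace.exp_zero] using this
  refine ⟨fun i => b i - ntr (b i) • 1, ⟨fun i => ?_, fun i => ?_, fun i => ?_, fun i => ?_,
    ncard_not_disjoint_ball_le bc R⟩, ?_⟩
  · exact (hbacts i).sub ((actsOn_one _).smul _)
  · rw [ntr_sub, ntr_smul, ntr_one, mul_one, sub_self]
  · rw [Matrix.IsHermitian, Matrix.conjTranspose_sub, Matrix.conjTranspose_smul, hntr,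
      Matrix.conjTranspose_one, (hbherm i).eq]
  · have h1 := norm_sub_le (b i) (ntr (b i) • (1 : Operator d))
    have h2 := norm_smul_le (ntr (b i)) (1 : Operator d)
    have h3 := norm_ntr_le (b i)
    have h4 := hbnorm i
    have h5 : ‖ntr (b i)‖ * ‖(1 : Operator d)‖ ≤ ‖ntr (b i)‖ * 1 := by gcongr
    linarith
  · rw [Finset.sum_sub_distrib, ← Finset.sum_smul, ← ntr_sum, hbsum]

end Reduction

/-! ### Choice of scales and the averaged bound. -/

section Main

variable {D M : ℕ} {d : Site D M → ℕ} {bc : Fin D → Bool} {R Δ : ℕ} {g : ℝ}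
  {a : Site D M → Operator d}

theorem card_site_eq (hD : 1 ≤ D) : (Fintype.card (Site D M) : ℝ) = M * (M : ℝ) ^ (D - 1) := by
  rw [← pow_succ', Nat.sub_add_cancel hD]
  simp

/-- With `W = w P` the block volume, the mean block variance is at least `q² W / 4`, and `hsmall`
makes the fourth moment term at most `t² W q² / 5`. The constant is `5/12 · 1/4 - 5/24 · 1/5 =
1/16`. -/
theorem block_exponent_le {q A t s T w m P v G g Δ : ℝ} {K : ℕ} (hm : 0 < m) (hq : 0 < q)
    (hP : 0 < P) (hA : 0 < A) (hw : m ^ 3 ≤ w) (hw' : w ≤ 2 * m ^ 3) (hK : 0 < K)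
    (hKw : K * w ≤ m ^ 5) (hv : q ^ 2 * (m ^ 5 * P) / 4 ≤ v) (ht : 0 ≤ t) (htT : t ≤ T)
    (hst : t = s * T) (hT : T ^ 2 * (P * m ^ 3) = A * q ^ 4) (hqG : q ^ 2 ≤ G)
    (hsmall : 10 * (7 * g ^ 4 * Δ ^ 2) * G * A ≤ 1) :
    -(5 / 12) * (t ^ 2 * (v / K)) + 5 / 24 * (t ^ 4 * (7 * g ^ 4 * (Δ * (w * P)) ^ 2)) ≤
      -(s ^ 2 * (A / 16 * q ^ 6)) := by
  have hK' : (0 : ℝ) < K := by exact_mod_cast hK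
  have hw0 : 0 < w := lt_of_lt_of_le (by positivity) hw
  have h4 : 0 ≤ 7 * g ^ 4 * Δ ^ 2 := by positivity
  have ht2 : 0 ≤ t ^ 2 := sq_nonneg t
  set W := w * P with hW
  have hW0 : 0 < W := by positivity
  have f1 : q ^ 2 * W / 4 ≤ v / K := by
    rw [le_div_iff₀ hK']
    calc q ^ 2 * W / 4 * K = q ^ 2 * P / 4 * (K * w) := by rw [hW]; ring
      _ ≤ q ^ 2 * P / 4 * m ^ 5 := by gcongr
      _ = q ^ 2 * (m ^ 5 * P) / 4 := by ring
      _ ≤ v := hv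
  have f2 : t ^ 2 * W ≤ 2 * (A * q ^ 4) := by
    rw [← hT]
    calc t ^ 2 * W ≤ T ^ 2 * (2 * m ^ 3 * P) := by rw [hW]; gcongr
      _ = _ := by ring
  have f3 : t ^ 4 * (7 * g ^ 4 * (Δ * W) ^ 2) ≤ t ^ 2 * W * q ^ 2 / 5 := by
    have : 7 * g ^ 4 * Δ ^ 2 * (t ^ 2 * W) ≤ q ^ 2 / 5 := by
      calc 7 * g ^ 4 * Δ ^ 2 * (t ^ 2 * W) ≤ 7 * g ^ 4 * Δ ^ 2 * (2 * (A * q ^ 4)) := by gcongr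
        _ = 2 * (7 * g ^ 4 * Δ ^ 2) * A * q ^ 2 * q ^ 2 := by ring
        _ ≤ 2 * (7 * g ^ 4 * Δ ^ 2) * A * G * q ^ 2 := by gcongr
        _ = (10 * (7 * g ^ 4 * Δ ^ 2) * G * A) * (q ^ 2 / 5) := by ring
        _ ≤ 1 * (q ^ 2 / 5) := by gcongr
        _ = _ := one_mul _
    calc t ^ 4 * (7 * g ^ 4 * (Δ * W) ^ 2) = t ^ 2 * W * (7 * g ^ 4 * Δ ^ 2 * (t ^ 2 * W)) := by ring
      _ ≤ t ^ 2 * W * (q ^ 2 / 5) := by gcongr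
      _ = _ := by ring
  have f4 : s ^ 2 * (A * q ^ 4) ≤ t ^ 2 * W := by
    rw [← hT, hst, hW]
    calc s ^ 2 * (T ^ 2 * (P * m ^ 3)) = (s * T) ^ 2 * (m ^ 3 * P) := by ring
      _ ≤ _ := by gcongr
  have f5 := mul_le_mul_of_nonneg_left f1 ht2
  have f6 := mul_le_mul_of_nonneg_right f4 (sq_nonneg q)
  linarith

theorem average_norm_ntr_evol_le [Nonempty (Config d)] (hD : 1 ≤ D)
    (ha : IsBoundedFamily (ball bc R) g Δ a) (hR : 0 < R) {m q A T : ℝ} (hm : 1 ≤ m)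
    (hM : (M : ℝ) = m ^ 5) (hq : 0 < q) (hA : 0 < A) (hT : 0 < T)
    (hvar : mom2 (∑ i, a i) = q ^ 2 * (m ^ 5 * (M : ℝ) ^ (D - 1)))
    (hTsq : T ^ 2 * ((M : ℝ) ^ (D - 1) * m ^ 3) = A * q ^ 4)
    (hsmall : 10 * (7 * g ^ 4 * (Δ : ℝ) ^ 2) * (Δ * g ^ 2) * A ≤ 1)
    (hbulk : 24 * R * (Δ * g ^ 2) ≤ q ^ 2 * m ^ 2) :
    1 / T * ∫ t in (0 : ℝ)..T, ‖ntr (evol (∑ i, a i) t)‖ ≤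
      √(Real.pi / (A / 16 * q ^ 6 * m ^ 2 / 4)) / 2 +
        (1 / (A / 16 * q ^ 2) + √(4 * R * (Δ * g ^ 2) * A * (1 + (Δ * g ^ 2) ^ 2))) / m := by
  have hm0 : 0 < m := by linarith
  have hR1 : (1 : ℝ) ≤ R := by exact_mod_cast hR
  set P : ℝ := (M : ℝ) ^ (D - 1) with hPdef
  set G : ℝ := Δ * g ^ 2 with hG
  have hG0 : 0 ≤ G := by positivity
  have hP : 0 < P := by
    rw [hPdef, hM]; positivity
  have hqG : q ^ 2 ≤ G := by
    have h := mom2_sum_le ha Finset.univ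
    rw [hvar, Finset.card_univ, card_site_eq hD, ← hPdef, hM] at h
    exact le_of_mul_le_mul_right h (by positivity)
  -- The width `m³` balances the Gaussian average, of order `1 / √K` with `K` about `m²` blocks,
  -- against the decoupling error; both are of order `1 / m`.
  set w := ⌈m ^ 3⌉₊ with hwdef
  have hw1 : m ^ 3 ≤ w := Nat.le_ceil _
  have hm3 : 1 ≤ m ^ 3 := one_le_pow₀ hm
  have hw2 : (w : ℝ) ≤ 2 * m ^ 3 := by
    have := Nat.ceil_lt_add_one (a := m ^ 3) (by positivity)
    linarith
  have hw0 : 0 < w := Nat.ceil_pos.2 (by positivity)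
  have hwM : w ≤ M := Nat.ceil_le.2 (by rw [hM]; exact pow_le_pow_right₀ hm (by norm_num))
  have hK0 : 0 < M / w := Nat.div_pos hwM hw0
  have hKw : ((M / w : ℕ) : ℝ) * w ≤ m ^ 5 := by
    rw [← hM]; exact_mod_cast Nat.div_mul_le_self M w
  have hK1 : (1 : ℝ) ≤ (M / w : ℕ) := by exact_mod_cast hK0
  have hKlow : m ^ 2 / 4 ≤ (M / w : ℕ) := by
    have h1 : m ^ 5 ≤ (((M / w : ℕ) : ℝ) + 1) * w := by
      rw [← hM, add_mul, one_mul]; exact_mod_cast (Nat.lt_div_mul_add hw0).le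
    refine le_of_mul_le_mul_right (a := m ^ 3) ?_ (by positivity)
    calc m ^ 2 / 4 * m ^ 3 = m ^ 5 / 4 := by ring
      _ ≤ (((M / w : ℕ) : ℝ) + 1) * w / 4 := by gcongr
      _ ≤ (((M / w : ℕ) : ℝ) + (M / w : ℕ)) * (2 * m ^ 3) / 4 := by gcongr
      _ = _ := by ring
  have hKm : ((M / w : ℕ) : ℝ) ≤ m ^ 3 := by
    refine le_of_mul_le_mul_right (a := m ^ 3) ?_ (by positivity)
    calc ((M / w : ℕ) : ℝ) * m ^ 3 ≤ (M / w : ℕ) * w := by gcongr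
      _ ≤ m ^ 5 := hKw
      _ ≤ m ^ 6 := pow_le_pow_right₀ hm (by norm_num)
      _ = _ := by ring
  let δ₀ : Fin D := ⟨0, hD⟩
  -- By `hbulk` the terms outside the blocks contribute at most half of the total variance in the
  -- splitting bound; its factor two leaves a quarter for the blocks.
  have hv : q ^ 2 * (m ^ 5 * P) / 4 ≤ ∑ b, mom2 (blockTerm δ₀ R w a b) := by
    have h := mom2_sum_le_sum_mom2_blockTerm (δ₀ := δ₀) ha hw0
    rw [hvar] at h
    have h1 : G * (((M / w : ℕ) : ℝ) * (4 * R) + w) ≤ q ^ 2 * m ^ 5 / 4 := by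
      calc G * (((M / w : ℕ) : ℝ) * (4 * R) + w) ≤ G * (m ^ 3 * (4 * R) + 2 * m ^ 3 * R) := by
            gcongr
            nlinarith
        _ = 24 * R * G * (m ^ 3 / 4) := by ring
        _ ≤ q ^ 2 * m ^ 2 * (m ^ 3 / 4) := by gcongr
        _ = _ := by ring
    have h2 := mul_le_mul_of_nonneg_right h1 hP.le
    linarith
  refine average_le_of_le_gaussian_add (continuous_ntr.comp (continuous_evol _)).norm hT
    (by positivity) fun t ht => ?_
  have hs : 0 < t / T := div_pos ht.1 hT
  have hs1 : t / T ≤ 1 := (div_le_one hT).2 ht.2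
  have hst : t = t / T * T := by field_simp
  have hmain := le_gaussian_add_of_forall_le (y := ‖ntr (evol (∑ i, a i) t)‖) (A := A / 16)
    (E := 4 * R * G * A) hs hs1 hm hq (by positivity) (by positivity) hKlow fun k hk => by
      refine (norm_ntr_evol_sum_le_exp δ₀ ha hk hK0 ht.1.le).trans (add_le_add ?_ (le_of_eq ?_))
      · refine Real.exp_le_exp.2 ?_
        rw [← mul_neg]
        exact mul_le_mul_of_nonneg_left (block_exponent_le hm0 hq hP hA hw1 hw2 hK0 hKw hv ht.1.le
          ht.2 hst hTsq hqG hsmall) (Nat.cast_nonneg k)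
      · rw [← Real.sqrt_sq ht.1.le, ← Real.sqrt_mul (sq_nonneg t), Real.sqrt_sq ht.1.le]
        congr 1
        have : t ^ 2 * P = A * (t / T) ^ 2 * q ^ 4 / m ^ 3 := by
          rw [eq_div_iff (by positivity), mul_assoc (t ^ 2), mul_right_comm A, ← hTsq]
          field_simp
        calc t ^ 2 * (G * (k * (4 * R * P))) = t ^ 2 * P * (4 * R * G * k) := by ring
          _ = _ := by rw [this]; ring
  refine hmain.trans (add_le_add_right ?_ _)
  have hq4 : q ^ 4 ≤ G ^ 2 := by
    calc q ^ 4 = (q ^ 2) ^ 2 := by ring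
      _ ≤ G ^ 2 := by gcongr
  gcongr

end Main

end LocalHam

theorem theorem1 (D : ℕ) (hD : 1 ≤ D) (R : ℕ) (hR : 0 < R) (h : ℝ) :
    ∃ a₀ b₀ : ℝ, 0 < a₀ ∧ 0 < b₀ ∧
      ∀ (M : ℕ) (_ : (4 : ℝ) ^ (3 / 2 : ℝ) * (R : ℝ) ≤ (M : ℝ) ^ (3 / 5 : ℝ))
        (bc : Fin D → Bool) (d : LocalHam.Site D M → ℕ) (_ : ∀ i, 1 ≤ d i)
        (H : LocalHam.Operator d) (_ : LocalHam.IsLocalHamiltonian bc R h d H)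
        (_ : 0 < LocalHam.sigmaBar H) (N : ℕ) (_ : N = M ^ D)
        (T : ℝ) (_ : T = a₀ * LocalHam.sigmaBar H ^ 2 *
          (N : ℝ) ^ (1 / (5 * (D : ℝ)) - 1 / 2 : ℝ)),
        1 / T * ∫ t in (0 : ℝ)..T, ‖LocalHam.phi H t‖ ≤
          b₀ * (1 + (LocalHam.sigmaBar H)⁻¹ ^ 3) / (N : ℝ) ^ (1 / (5 * (D : ℝ)) : ℝ) := by
  open LocalHam in
  set g : ℝ := 2 * (|h| + 1) with hg
  set Δ : ℕ := (4 * R + 1) ^ (2 * D) with hΔ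
  have hg0 : 0 < g := by positivity
  have hΔ0 : (0 : ℝ) < Δ := by exact_mod_cast (by positivity : 0 < (4 * R + 1) ^ (2 * D))
  have hR0 : (0 : ℝ) < R := by exact_mod_cast hR
  set G : ℝ := Δ * g ^ 2 with hG
  have hG0 : 0 < G := by positivity
  -- Small enough that the fourth moment term is dominated, with `A = a₀²`; the leading `1` also
  -- gives `a₀ ≤ 1`.
  set a₀ : ℝ := 1 / (1 + 10 * (7 * g ^ 4 * (Δ : ℝ) ^ 2) * G) with ha₀
  have ha₀pos : 0 < a₀ := by positivity
  have ha₀1 : a₀ ≤ 1 := by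
    rw [ha₀, div_le_one (by positivity)]
    linarith [show 0 ≤ 10 * (7 * g ^ 4 * (Δ : ℝ) ^ 2) * G by positivity]
  have hsmall : 10 * (7 * g ^ 4 * (Δ : ℝ) ^ 2) * G * a₀ ^ 2 ≤ 1 := by
    have h1 : (1 + 10 * (7 * g ^ 4 * (Δ : ℝ) ^ 2) * G) * a₀ = 1 := by
      rw [ha₀]; field_simp
    nlinarith
  set E : ℝ := √(4 * R * G * a₀ ^ 2 * (1 + G ^ 2)) with hE
  -- The summands of `b₀` stem from the Gaussian average, the exponential at the optimal `k`, the
  -- decoupling error and the trivial case.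
  refine ⟨a₀, 4 * √Real.pi / a₀ + 16 / a₀ ^ 2 + E + G * √(24 * R * G), ha₀pos, by positivity, ?_⟩
  intro M hMR bc d hd H hH hq N hN T hT
  have hne : Nonempty (Config d) := ⟨fun i => ⟨0, hd i⟩⟩
  set q := sigmaBar H with hqdef
  have hM0 : 0 < M := by
    rcases Nat.eq_zero_or_pos M with rfl | h0
    · rw [Nat.cast_zero, Real.zero_rpow (by norm_num)] at hMR
      have : (0 : ℝ) < 4 ^ (3 / 2 : ℝ) * R := by positivity
      linarith
    · exact h0
  have hMr : (1 : ℝ) ≤ M := by exact_mod_cast hM0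
  have hDr : (D : ℝ) ≠ 0 := by exact_mod_cast (by omega : D ≠ 0)
  set m : ℝ := (M : ℝ) ^ (1 / 5 : ℝ) with hm
  have hm1 : 1 ≤ m := Real.one_le_rpow hMr (by norm_num)
  have hm0 : 0 < m := by linarith
  have hm5 : (M : ℝ) = m ^ 5 := by
    rw [hm, ← Real.rpow_natCast, ← Real.rpow_mul (by positivity)]
    norm_num
  set P : ℝ := (M : ℝ) ^ (D - 1) with hP
  have hP0 : 0 < P := by positivity
  have hNr : (N : ℝ) = (M : ℝ) ^ D := by rw [hN]; push_cast; rfl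
  have hNP : (N : ℝ) = m ^ 5 * P := by
    rw [hNr, hP, ← hm5, ← pow_succ', Nat.sub_add_cancel hD]
  have hN0 : (0 : ℝ) < N := by rw [hNP]; positivity
  have hNm : (N : ℝ) ^ (1 / (5 * (D : ℝ)) : ℝ) = m := by
    rw [hNr, hm, ← Real.rpow_natCast, ← Real.rpow_mul (by positivity)]
    congr 1
    field_simp
  rw [Real.rpow_sub hN0, hNm, ← Real.sqrt_eq_rpow] at hT
  rw [hNm]
  have hT0 : 0 < T := by rw [hT]; positivity
  have hTsq : T ^ 2 * (P * m ^ 3) = a₀ ^ 2 * q ^ 4 := by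
    rw [hT, mul_pow, div_pow, Real.sq_sqrt hN0.le, hNP]
    field_simp
  obtain ⟨a, ha, hsum⟩ := exists_isBoundedFamily hH
  have hherm : (∑ i, a i).IsHermitian := isHermitian_sum ha.isHermitian
  have hphi : ∀ t, ‖phi H t‖ = ‖ntr (evol (∑ i, a i) t)‖ := fun t => by
    rw [norm_phi_eq hH.isHermitian, hsum]
  have hvar : mom2 (∑ i, a i) = q ^ 2 * (m ^ 5 * P) := by
    have h1 : energyVar H = mom2 (∑ i, a i) := by rw [hsum]; rfl
    rw [hqdef, sigmaBar, Real.sq_sqrt, h1, ← hN, ← hNP]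
    · field_simp
    · rw [h1]; exact div_nonneg (mom2_nonneg hherm) (Nat.cast_nonneg _)
  have hqG : q ^ 2 ≤ G := by
    have h := mom2_sum_le ha Finset.univ
    rw [hvar, Finset.card_univ, card_site_eq hD, ← hP, hm5] at h
    exact le_of_mul_le_mul_right h (by positivity)
  simp only [hphi]
  have hq3 : 0 < q⁻¹ ^ 3 := by positivity
  -- Otherwise `q m < √(24 R G)`, and `q² ≤ G` gives `m ≤ G √(24 R G) q⁻³`, so the bound `|φ| ≤ 1`
  -- is enough.
  by_cases hbulk : 24 * R * G ≤ q ^ 2 * m ^ 2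
  · refine (average_norm_ntr_evol_le hD ha hR hm1 hm5 hq (pow_pos ha₀pos 2) hT0 hvar hTsq hsmall
      hbulk).trans ?_
    have h1 : √(Real.pi / (a₀ ^ 2 / 16 * q ^ 6 * m ^ 2 / 4)) / 2 =
        4 * √Real.pi / a₀ * q⁻¹ ^ 3 / m := by
      rw [Real.sqrt_div Real.pi_pos.le, show a₀ ^ 2 / 16 * q ^ 6 * m ^ 2 / 4 =
        (a₀ * q ^ 3 * m / 8) ^ 2 by ring, Real.sqrt_sq (by positivity)]
      field_simp
      norm_num
    have h2 : 1 / (a₀ ^ 2 / 16 * q ^ 2) ≤ 16 / a₀ ^ 2 * (1 + q⁻¹ ^ 3) := by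
      have h3 : q⁻¹ ^ 2 ≤ 1 + q⁻¹ ^ 3 := by
        have hx : 0 < q⁻¹ := by positivity
        rcases le_total q⁻¹ 1 with h | h
        · linarith [pow_le_one₀ (n := 2) hx.le h]
        · linarith [pow_le_pow_right₀ h (show 2 ≤ 3 by norm_num)]
      calc 1 / (a₀ ^ 2 / 16 * q ^ 2) = 16 / a₀ ^ 2 * q⁻¹ ^ 2 := by field_simp
        _ ≤ _ := by gcongr
    rw [h1, ← add_div]
    have h4 : 0 ≤ 4 * √Real.pi / a₀ := by positivity
    have h5 : 0 ≤ E * q⁻¹ ^ 3 := by positivity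
    have h6 : 0 ≤ G * √(24 * R * G) * (1 + q⁻¹ ^ 3) := by positivity
    gcongr
    linarith
  · push Not at hbulk
    have h1 : 1 / T * ∫ t in (0 : ℝ)..T, ‖ntr (evol (∑ i, a i) t)‖ ≤ 1 := by
      have h2 : ∫ t in (0 : ℝ)..T, ‖ntr (evol (∑ i, a i) t)‖ ≤ ∫ _t in (0 : ℝ)..T, (1 : ℝ) :=
        intervalIntegral.integral_mono_on hT0.le
          ((continuous_ntr.comp (continuous_evol _)).norm.intervalIntegrable _ _)
          (continuous_const.intervalIntegrable _ _) fun t _ => norm_ntr_evol_le_one hherm t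
      rw [intervalIntegral.integral_const, sub_zero, smul_eq_mul, mul_one] at h2
      rw [one_div, inv_mul_le_iff₀ hT0, mul_one]
      exact h2
    refine h1.trans ?_
    rw [le_div_iff₀ hm0, one_mul]
    have h3 : q * m ≤ √(24 * R * G) := Real.le_sqrt_of_sq_le (by rw [mul_pow]; exact hbulk.le)
    have h4 : m ≤ G * √(24 * R * G) * q⁻¹ ^ 3 := by
      calc m = q ^ 2 * (q * m) * q⁻¹ ^ 3 := by field_simp
        _ ≤ _ := by gcongr
    have h5 : 0 ≤ (4 * √Real.pi / a₀ + 16 / a₀ ^ 2 + E) * (1 + q⁻¹ ^ 3) := by positivity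
    have h6 : 0 ≤ G * √(24 * R * G) := by positivity
    linarith
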